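/- Let $G$ be a compact Lie group with a bi-invariant Riemannian metric $ds^2_G$, equip $G\times G$ with the metric $ds^2_{G\times G}=2(ds^2_G\oplus ds^2_G)$, and let $m:G\times G\to G$, $m(x,y)=xy$, be the multiplication map. For a Riemannian manifold $M$ let $\Delta^1_M=d\delta+\delta d$ be the Laplace-Beltrami operator on (real- or complex-valued) $1$-forms, and let $E_\mu(\Delta^1_M)$ be the space of smooth $1$-forms $\theta$ on $M$ with $\Delta^1_M\theta=\mu\theta$. Let $\lambda\in\mathbb R$ and let $0\neq\phi\in E_\lambda(\Delta^1_G)$ be left invariant, i.e. $L_a^*\phi=\phi$ for every left translation $L_a:x\mapsto ax$. Then one may decompose $m^*\phi=\Phi_1+\Phi_2$ where $0\neq\Phi_1\in E_{\frac32\lambda}(\Delta^1_{G\times G})$ and $0\neq\Phi_2\in E_{\frac12\lambda}(\Delta^1_{G\times G})$. -/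

import Mathlib

open scoped Manifold ContDiff Bundle

noncomputable section

namespace LieForms

section Manifold

variable {E : Type*} [NormedAddCommGroup E] [NormedSpace ℝ E]
  {H : Type*} [TopologicalSpace H]
  {E' : Type*} [NormedAddCommGroup E'] [NormedSpace ℝ E']
  {H' : Type*} [TopologicalSpace H']
  {F : Type*} [NormedAddCommGroup F] [NormedSpace ℝ F]

/-- Differential `p`-forms on `M` with values in `F` (no regularity yet): an alternating
`p`-linear map on each tangent space. -/
abbrev DiffForm (I : ModelWithCorners ℝ E H) (M : Type*) [TopologicalSpace M] [ChartedSpace H M]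
    (p : ℕ) (F : Type*) [NormedAddCommGroup F] [NormedSpace ℝ F] : Type _ :=
  (x : M) → TangentSpace I x [⋀^Fin p]→L[ℝ] F

/-- Fields of bilinear forms on the tangent spaces of `M`; Riemannian metrics are such fields. -/
abbrev BilinField (I : ModelWithCorners ℝ E H) (M : Type*) [TopologicalSpace M]
    [ChartedSpace H M] : Type _ :=
  (x : M) → TangentSpace I x →L[ℝ] TangentSpace I x →L[ℝ] ℝ

variable {I : ModelWithCorners ℝ E H} {I' : ModelWithCorners ℝ E' H'}
  {M : Type*} [TopologicalSpace M] [ChartedSpace H M]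
  {N : Type*} [TopologicalSpace N] [ChartedSpace H' N] {p : ℕ}

/-- The pullback `f^*θ` of a form along `f : M → N`. -/
def pullback (I : ModelWithCorners ℝ E H) (I' : ModelWithCorners ℝ E' H') (f : M → N)
    (θ : DiffForm I' N p F) : DiffForm I M p F :=
  fun x => (θ (f x)).compContinuousLinearMap (mfderiv I I' f x)

/-- The pullback `f^*g` of a field of bilinear forms, `(f^*g)(u, v) = g(df u, df v)`. -/
def pullbackBilin (I : ModelWithCorners ℝ E H) (I' : ModelWithCorners ℝ E' H') (f : M → N)
    (g : BilinField I' N) : BilinField I M :=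
  fun x => ContinuousLinearMap.precomp ℝ (mfderiv I I' f x) ∘L g (f x) ∘L mfderiv I I' f x

/-- The coordinate expression on the model space `E` of a form, in the chart of `M` at `x`. -/
def inChart (θ : DiffForm I M p F) (x : M) : E → E [⋀^Fin p]→L[ℝ] F :=
  pullback 𝓘(ℝ, E) I (extChartAt I x).symm θ

/-- The coordinate expression `(g_{ij})` on `E` of a metric, in the chart of `M` at `x`. -/
def metricInChart (g : BilinField I M) (x : M) : E → E →L[ℝ] E →L[ℝ] ℝ :=
  pullbackBilin 𝓘(ℝ, E) I (extChartAt I x).symm g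

/-- Smooth (`C^∞`) forms on a manifold without boundary: all coordinate expressions are smooth. -/
def IsSmooth (θ : DiffForm I M p F) : Prop :=
  ∀ x : M, ContDiffOn ℝ ∞ (inChart θ x) (extChartAt I x).target

/-- The exterior derivative `d`, computed at `x` in the chart at `x`. -/
def extD (θ : DiffForm I M p F) : DiffForm I M (p + 1) F :=
  fun x => pullback I 𝓘(ℝ, E) (extChartAt I x) (extDeriv (inChart θ x)) x

end Manifold

section Coordinates

variable {E : Type*} [NormedAddCommGroup E] [NormedSpace ℝ E]
  {F : Type*} [NormedAddCommGroup F] [NormedSpace ℝ F] {p : ℕ}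

/-- The Christoffel symbols of a metric `g` on an open subset of `E`: the vector `Γ(u, v)` with
`g(Γ(u, v), w) = (D_u g(v, w) + D_v g(u, w) - D_w g(u, v)) / 2` for all `w`. -/
def christoffel (g : E → E →L[ℝ] E →L[ℝ] ℝ) (y : E) (u : E) : E →L[ℝ] E :=
  (g y).inverse ∘L ((1 / 2 : ℝ) •
    (fderiv ℝ g y u + (fderiv ℝ g y).flip u - ((fderiv ℝ g y).flip u).flip))

theorem sum_comp_update (A : E →L[ℝ] E) (θ : E [⋀^Fin p]→L[ℝ] F) (v : Fin p → E) :
    (∑ j, θ.toContinuousMultilinearMap.compContinuousLinearMap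
      (fun i => if i = j then A else ContinuousLinearMap.id ℝ E)) v =
      ∑ j, θ (Function.update v j (A (v j))) := by
  rw [sum_apply]
  refine Finset.sum_congr rfl fun j _ => ?_
  rw [ContinuousMultilinearMap.compContinuousLinearMap_apply]
  refine congrArg θ (funext fun i => ?_)
  by_cases h : i = j
  · subst h
    simp
  · simp [h]

theorem sum_update_eq_zero (A : E →L[ℝ] E) (θ : E [⋀^Fin p]→L[ℝ] F) (v : Fin p → E)
    (a b : Fin p) (hab : v a = v b) (hne : a ≠ b) :
    ∑ j, θ (Function.update v j (A (v j))) = 0 := by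
  rw [← Finset.add_sum_erase _ _ (Finset.mem_univ a),
    ← Finset.add_sum_erase _ _ (Finset.mem_erase.2 ⟨hne.symm, Finset.mem_univ b⟩),
    Finset.sum_eq_zero, add_zero]
  · have h : Function.update v b (A (v b)) =
        Function.update v a (A (v a)) ∘ Equiv.swap a b := by
      funext i
      by_cases hia : i = a
      · subst hia
        simp [hne, hne.symm, hab]
      · by_cases hib : i = b
        · subst hib
          simp [hab]
        · simp [Equiv.swap_apply_of_ne_of_ne hia hib, hia, hib]
    rw [h]
    exact θ.toAlternatingMap.map_add_swap _ hne
  · intro j hj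
    simp only [Finset.mem_erase, Finset.mem_univ, and_true] at hj
    refine θ.map_eq_zero_of_eq _ ?_ hne
    rw [Function.update_of_ne hj.2.symm, Function.update_of_ne hj.1.symm, hab]

/-- The action of an endomorphism `A` of `E` on alternating maps as a derivation,
`(A · θ)(v₁, …, vₚ) = ∑ⱼ θ(v₁, …, A vⱼ, …, vₚ)`. -/
def derivAction (A : E →L[ℝ] E) (θ : E [⋀^Fin p]→L[ℝ] F) : E [⋀^Fin p]→L[ℝ] F :=
  { (∑ j, θ.toContinuousMultilinearMap.compContinuousLinearMap
      (fun i => if i = j then A else ContinuousLinearMap.id ℝ E)) with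
    map_eq_zero_of_eq' := by
      intro v a b hab hne
      exact (sum_comp_update A θ v).trans (sum_update_eq_zero A θ v a b hab hne) }

theorem derivAction_apply (A : E →L[ℝ] E) (θ : E [⋀^Fin p]→L[ℝ] F) (v : Fin p → E) :
    derivAction A θ v = ∑ j, θ (Function.update v j (A (v j))) :=
  sum_comp_update A θ v

/-- The Levi-Civita covariant derivative `∇_u θ` at `y` of a form on an open subset of `E`. -/
def covDeriv (g : E → E →L[ℝ] E →L[ℝ] ℝ) (θ : E → E [⋀^Fin p]→L[ℝ] F) (y u : E) :
    E [⋀^Fin p]→L[ℝ] F :=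
  fderiv ℝ θ y u - derivAction (christoffel g y u) (θ y)

/-- The codifferential in coordinates, `δθ = - ∑ᵢⱼ g^{ij} (∇_{∂ᵢ} θ)(∂ⱼ, ·, …, ·)`. The vector
`∑ⱼ g^{ij} ∂ⱼ` is written as the `g`-dual of the `i`-th coordinate functional. -/
def coordCodiff [FiniteDimensional ℝ E] (g : E → E →L[ℝ] E →L[ℝ] ℝ)
    (θ : E → E [⋀^Fin (p + 1)]→L[ℝ] F) (y : E) : E [⋀^Fin p]→L[ℝ] F :=
  - ∑ i, (covDeriv g θ y (Module.finBasis ℝ E i)).curryLeft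
      ((g y).inverse (LinearMap.toContinuousLinearMap ((Module.finBasis ℝ E).coord i)))

end Coordinates

section Laplacian

variable {E : Type*} [NormedAddCommGroup E] [NormedSpace ℝ E] [FiniteDimensional ℝ E]
  {H : Type*} [TopologicalSpace H] {I : ModelWithCorners ℝ E H}
  {M : Type*} [TopologicalSpace M] [ChartedSpace H M]
  {F : Type*} [NormedAddCommGroup F] [NormedSpace ℝ F] {p : ℕ}

/-- The codifferential `δ` of the Riemannian metric `g` on `M`, the formal adjoint of `d`, given by
minus the trace of the Levi-Civita covariant derivative, computed at `x` in the chart at `x`. -/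
def codiff (g : BilinField I M) (θ : DiffForm I M (p + 1) F) : DiffForm I M p F :=
  fun x => pullback I 𝓘(ℝ, E) (extChartAt I x) (coordCodiff (metricInChart g x) (inChart θ x)) x

/-- The Laplace-Beltrami operator `Δ^p = dδ + δd` on `p`-forms (`Δ^0 = δd`). -/
def laplacian (g : BilinField I M) : (p : ℕ) → DiffForm I M p F → DiffForm I M p F
  | 0, θ => codiff g (extD θ)
  | _ + 1, θ => extD (codiff g θ) + codiff g (extD θ)

/-- The eigenspace `E_μ(Δ^p)` of smooth `p`-forms `θ` with `Δ^p θ = μ θ`. -/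
def eigenspace (g : BilinField I M) (p : ℕ) (F : Type*) [NormedAddCommGroup F] [NormedSpace ℝ F]
    (μ : ℝ) : Set (DiffForm I M p F) :=
  {θ | IsSmooth θ ∧ laplacian g p θ = μ • θ}

end Laplacian

section LieGroup

variable {E : Type*} [NormedAddCommGroup E] [NormedSpace ℝ E]
  {H : Type*} [TopologicalSpace H] {I : ModelWithCorners ℝ E H}
  {G : Type*} [TopologicalSpace G] [ChartedSpace H G]
  {F : Type*} [NormedAddCommGroup F] [NormedSpace ℝ F] {p : ℕ}

/-- A metric on a Lie group is bi-invariant if all left and right translations are isometries. -/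
def IsBiInvariant [Group G] (g : BilinField I G) : Prop :=
  ∀ a : G, pullbackBilin I I (fun x => a * x) g = g ∧ pullbackBilin I I (fun x => x * a) g = g

/-- Left invariant forms: `L_a^*θ = θ` for all `a`. -/
def IsLeftInvariant [Group G] (θ : DiffForm I G p F) : Prop :=
  ∀ a : G, pullback I I (fun x => a * x) θ = θ

/-- The metric `2 (ds² ⊕ ds²)` on `G × G`. -/
def doubleMetric (g : BilinField I G) : BilinField (I.prod I) (G × G) :=
  fun x => (2 : ℝ) • (pullbackBilin (I.prod I) I Prod.fst g x +
    pullbackBilin (I.prod I) I Prod.snd g x)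

end LieGroup

end LieForms

end

/-!
The left invariant vector fields of `G` form a global frame `e` of `TG`, modelled on
`E = T_1 G`, in which the metric has constant coefficients `B` and the Lie brackets are given by a
constant bracket `[·, ·]` on `E`; bi-invariance makes `ad u` skew for `B`. The Koszul formula then
reads `∇_u v = [u, v] / 2`, and `d`, `δ` become constant coefficient expressions in the coefficient
functions `x ↦ θ_x(e_x v)` and their derivatives along the frame (`IsLieFrame.coeff_extD_one`,
`IsLieFrame.coeff_codiff`). These expressions do not refer to charts, which takes care of the fact
that `d` and `δ` are computed in a different chart at every point. The product of two such frames
is again such a frame for the metric `2 (g ⊕ g)` (`IsLieFrame.prod`).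

A left invariant form `φ` has constant coefficients `β v = φ_1(v)`. For constant coefficients
`δθ = 0` and `Δθ` has coefficients `-½ β ∘ Cas`, where `Cas = ∑ ad(bᵢ)²` for a `B`-orthonormal basis
`b`; hence `β ∘ Cas = -2μ β` (`formAtOne_casimir`). The pullback `m^*φ` has at `(x, y)` the
coefficients `(u, v) ↦ β(Ad(y⁻¹) u) + β v` (`coeff_pullback_mul`), and the two summands are the two
eigenforms:

* `β v` belongs to the pullback of `φ` under the second projection. Its coefficients are constant,
  and doubling the metric halves the eigenvalue (`pullback_snd_mem_eigenspace`).
* `β(Ad(y⁻¹) u)` is a matrix coefficient of the adjoint representation in `y` and a left invariant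
  form in `x`. As the derivative of `Ad(y⁻¹) w` along `e v` is `[Ad(y⁻¹) w, v]`, the second
  derivatives in `y` contribute the full Casimir operator and the direction of `x` one half of it,
  in total `½ (2μ + μ) = 3/2 μ` (`mem_eigenspace_of_coeff_adInv`).

The derivative of `Ad` comes from the symmetry of the second derivatives of `(s, t) ↦ s x t`, that
is, from the fact that left and right invariant fields commute (`frameDeriv_adInv`). Differentiating
the invariance of `B` under `Ad` shows that `ad u` is skew (`IsBiInvariant.lieForm_skew`). Since `G`
need not be connected, `Ad` is shown to preserve brackets, and thus to commute with `Cas`, by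
naturality of the Lie bracket under right translations (`adInv_bracket`).
-/

noncomputable section

namespace LieForms

/-! ### Contractions -/

/-- The contraction of a bilinear map with a map `ψ` from the dual, `∑ᵢ T(fᵢ, ψ(fⁱ))`, does not
depend on the basis. -/
theorem sum_basis_dual_eq {ι κ W X : Type*} [Fintype ι] [Fintype κ] [AddCommGroup W] [Module ℝ W]
    [AddCommGroup X] [Module ℝ X]
    (f : Module.Basis ι ℝ W) (c : Module.Basis κ ℝ W) (T : W →ₗ[ℝ] W →ₗ[ℝ] X)
    (ψ : (W →ₗ[ℝ] ℝ) →ₗ[ℝ] W) :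
    ∑ i, T (f i) (ψ (f.coord i)) = ∑ k, T (c k) (ψ (c.coord k)) := by
  have h : ∀ i, f.coord i = ∑ k, f.coord i (c k) • c.coord k := by
    intro i
    refine c.ext fun k => ?_
    classical
    simp [Finsupp.single_apply]
  calc ∑ i, T (f i) (ψ (f.coord i))
      = ∑ i, ∑ k, T (f.coord i (c k) • f i) (ψ (c.coord k)) := by
        refine Finset.sum_congr rfl fun i _ => ?_
        conv_lhs => rw [h i]
        simp [map_sum]
    _ = ∑ k, T (∑ i, f.coord i (c k) • f i) (ψ (c.coord k)) := by
        rw [Finset.sum_comm]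
        simp only [map_sum, LinearMap.sum_apply]
    _ = _ := by
        refine Finset.sum_congr rfl fun k _ => ?_
        congr 2
        exact f.sum_repr (c k)

/-! ### Moving frames at a point of a normed space -/

section LocalFrame

variable {E : Type*} [NormedAddCommGroup E] [NormedSpace ℝ E]
  {V : Type*} [NormedAddCommGroup V] [NormedSpace ℝ V]
  {F : Type*} [NormedAddCommGroup F] [NormedSpace ℝ F] {p : ℕ}
  {ι : Type*} [Fintype ι] [DecidableEq ι]

/-- `L` is a moving frame for the metric `g` near the point `y` of `E`, with model space `V`: the
vector fields `z ↦ L z v` have constant inner products `B v w`, and at `y` their Lie brackets are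
given by the bracket `br` of `V`, for which `B` is invariant. The brackets are only prescribed at
`y`, which is all that first order operators at `y` see. -/
structure IsLieFrameAt (g : E → E →L[ℝ] E →L[ℝ] ℝ) (L : E → V →L[ℝ] E) (B : V →L[ℝ] V →L[ℝ] ℝ)
    (br : V →L[ℝ] V →L[ℝ] V) (y : E) : Prop where
  inv : (L y).IsInvertible
  diff : DifferentiableAt ℝ L y
  metric : ∀ᶠ z in nhds y, ∀ v w, g z (L z v) (L z w) = B v w
  bracket : ∀ u v, fderiv ℝ L y (L y u) v - fderiv ℝ L y (L y v) u = L y (br u v)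
  skew : ∀ u v w, B (br u v) w = - B v (br u w)

/-- `b` is an orthogonal basis for `B`, with all vectors of squared length `s`. -/
def IsOrthoBasis (B : V →L[ℝ] V →L[ℝ] ℝ) (s : ℝ) (b : Module.Basis ι ℝ V) : Prop :=
  ∀ i j, B (b i) (b j) = if i = j then s else 0

namespace IsOrthoBasis

variable {B : V →L[ℝ] V →L[ℝ] ℝ} {s : ℝ} {b : Module.Basis ι ℝ V}

theorem apply_left (hb : IsOrthoBasis B s b) (i : ι) (w : V) : B (b i) w = s * b.repr w i := by
  conv_lhs => rw [← b.sum_repr w]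
  simp [-Module.Basis.sum_repr, map_sum, hb i, mul_comm]

theorem apply_right (hb : IsOrthoBasis B s b) (i : ι) (w : V) : B w (b i) = s * b.repr w i := by
  conv_lhs => rw [← b.sum_repr w]
  simp [-Module.Basis.sum_repr, map_sum, hb _ i, mul_comm]

theorem symm (hb : IsOrthoBasis B s b) (v w : V) : B v w = B w v := by
  conv_lhs => rw [← b.sum_repr v]
  conv_rhs => rw [← b.sum_repr v]
  simp [-Module.Basis.sum_repr, map_sum, hb.apply_left, hb.apply_right]

end IsOrthoBasis

namespace IsLieFrameAt

variable {g : E → E →L[ℝ] E →L[ℝ] ℝ} {L : E → V →L[ℝ] E} {B : V →L[ℝ] V →L[ℝ] ℝ}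
  {br : V →L[ℝ] V →L[ℝ] V} {y : E} {s : ℝ} {b : Module.Basis ι ℝ V}

theorem surj (h : IsLieFrameAt g L B br y) (w : E) : ∃ v, L y v = w := by
  obtain ⟨e, he⟩ := h.inv
  exact ⟨e.symm w, by rw [← he]; simp⟩

theorem inj (h : IsLieFrameAt g L B br y) {v w : V} (hvw : L y v = L y w) : v = w := by
  obtain ⟨e, he⟩ := h.inv
  rw [← he] at hvw
  exact e.injective hvw

theorem br_swap (h : IsLieFrameAt g L B br y) (u v : V) : br u v = - br v u := by
  apply h.inj
  rw [map_neg, ← h.bracket, ← h.bracket]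
  abel

/-- The inverse of the metric, expressed in an orthogonal frame. -/
theorem inverse_metric (h : IsLieFrameAt g L B br y) (hs : s ≠ 0) (hb : IsOrthoBasis B s b) :
    (g y).inverse =
      ∑ i, s⁻¹ • (ContinuousLinearMap.apply ℝ ℝ (L y (b i))).smulRight (L y (b i)) := by
  apply ContinuousLinearMap.inverse_eq
  · ext φ w
    obtain ⟨w, rfl⟩ := h.surj w
    conv_rhs => rw [← b.sum_repr w]
    simp [-Module.Basis.sum_repr, map_sum, h.metric.self_of_nhds, hb.apply_left]
    refine Finset.sum_congr rfl fun i _ => ?_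
    field_simp
  · ext w
    obtain ⟨w, rfl⟩ := h.surj w
    conv_rhs => rw [ContinuousLinearMap.id_apply, ← b.sum_repr w]
    simp [-Module.Basis.sum_repr, map_sum, h.metric.self_of_nhds, hb.apply_right]
    refine Finset.sum_congr rfl fun i _ => ?_
    rw [smul_smul, inv_mul_cancel_left₀ hs]

theorem inverse_metric_apply (h : IsLieFrameAt g L B br y) (hs : s ≠ 0) (hb : IsOrthoBasis B s b)
    (φ : E →L[ℝ] ℝ) : (g y).inverse φ = ∑ i, (s⁻¹ * φ (L y (b i))) • L y (b i) := by
  simp [h.inverse_metric hs hb, smul_smul]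

theorem metric_inverse (h : IsLieFrameAt g L B br y) (hs : s ≠ 0) (hb : IsOrthoBasis B s b)
    {φ : E →L[ℝ] ℝ} {v : V} (hv : ∀ w, φ (L y w) = B v w) : (g y).inverse φ = L y v := by
  rw [h.inverse_metric_apply hs hb]
  conv_rhs => rw [← b.sum_repr v]
  simp [-Module.Basis.sum_repr, map_sum, hv, hb.apply_right, hs]

variable [FiniteDimensional ℝ E]

/-- The metric is the transport of the constant form `B` by `(L z)⁻¹`, hence differentiable. -/
theorem differentiableAt_metric (h : IsLieFrameAt g L B br y) : DifferentiableAt ℝ g y := by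
  have : CompleteSpace E := FiniteDimensional.complete ℝ E
  obtain ⟨e, he⟩ := h.inv
  have : FiniteDimensional ℝ V := e.symm.toLinearEquiv.finiteDimensional
  have : CompleteSpace V := FiniteDimensional.complete ℝ V
  have hi : DifferentiableAt ℝ (fun z => (L z).inverse) y := by
    have := (contDiffAt_map_inverse (𝕜 := ℝ) (n := 1) e).differentiableAt one_ne_zero
    rw [he] at this
    exact this.comp y h.diff
  have hL : ∀ᶠ z in nhds y, (L z).IsInvertible := by
    have := h.diff.continuousAt.eventually (he ▸ ContinuousLinearEquiv.nhds e)
    exact this.mono fun z hz => hz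
  have hg : g =ᶠ[nhds y] fun z =>
      (ContinuousLinearMap.compL ℝ E V ℝ).flip (L z).inverse ∘L B ∘L (L z).inverse := by
    filter_upwards [h.metric, hL] with z hz hz'
    obtain ⟨e', he'⟩ := hz'
    ext v w
    have := hz (e'.symm v) (e'.symm w)
    rw [← he'] at this
    rw [← he']
    simpa using this
  refine DifferentiableAt.congr_of_eventuallyEq ?_ hg
  refine DifferentiableAt.clm_comp ?_ (DifferentiableAt.clm_comp (by fun_prop) hi)
  exact (ContinuousLinearMap.differentiableAt _).comp y hi

/-- The derivative of the constant functions `g(L u, L v)` vanishes. -/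
theorem fderiv_metric (h : IsLieFrameAt g L B br y) (d : E) (u v : V) :
    fderiv ℝ g y d (L y u) (L y v) =
      - g y (fderiv ℝ L y d u) (L y v) - g y (L y u) (fderiv ℝ L y d v) := by
  have hu : ∀ u, HasFDerivAt (fun z => L z u) ((fderiv ℝ L y).flip u) y := fun u => by
    simpa using! h.diff.hasFDerivAt.clm_apply (hasFDerivAt_const u y)
  have h1 := (h.differentiableAt_metric.hasFDerivAt.clm_apply (hu u)).clm_apply (hu v)
  have h2 : HasFDerivAt (fun z => g z (L z u) (L z v)) (0 : E →L[ℝ] ℝ) y :=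
    (hasFDerivAt_const (B u v) y).congr_of_eventuallyEq (h.metric.mono fun z hz => hz u v)
  have := DFunLike.congr_fun (h1.unique h2) d
  simp at this
  linarith

/-- The Koszul formula in a Lie frame: `∇_u v = [u, v] / 2`. -/
theorem christoffel_eq (h : IsLieFrameAt g L B br y) (hs : s ≠ 0) (hb : IsOrthoBasis B s b)
    (u v : V) : christoffel g y (L y u) (L y v) =
      L y ((1 / 2 : ℝ) • br u v) - fderiv ℝ L y (L y u) v := by
  obtain ⟨x, hx⟩ := h.surj (fderiv ℝ L y (L y u) v)
  have hc : christoffel g y (L y u) (L y v) = (g y).inverse (((1 / 2 : ℝ) •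
    (fderiv ℝ g y (L y u) + (fderiv ℝ g y).flip (L y u) -
      ((fderiv ℝ g y).flip (L y u)).flip)) (L y v)) := rfl
  rw [hc, ← hx, ← map_sub]
  refine h.metric_inverse hs hb fun w => ?_
  have hm := h.metric.self_of_nhds
  -- write all derivatives of the frame in the Koszul formula in terms of `x`, `x'`, `x''`
  obtain ⟨x', hx'⟩ := h.surj (fderiv ℝ L y (L y u) w)
  obtain ⟨x'', hx''⟩ := h.surj (fderiv ℝ L y (L y v) w)
  have e1 : fderiv ℝ L y (L y v) u = L y (x - br u v) := by
    rw [map_sub, hx, ← h.bracket]; abel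
  have e2 : fderiv ℝ L y (L y w) u = L y (x' - br u w) := by
    rw [map_sub, hx', ← h.bracket]; abel
  have e3 : fderiv ℝ L y (L y w) v = L y (x'' - br v w) := by
    rw [map_sub, hx'', ← h.bracket]; abel
  simp only [smul_apply, add_apply,
    sub_apply, ContinuousLinearMap.flip_apply, h.fderiv_metric, e1, e2, e3,
    ← hx, ← hx', ← hx'', hm, map_sub, map_smul, smul_eq_mul]
  have k1 := h.skew u v w
  have k2 := h.skew v u w
  have k3 : B (br v u) w = - B (br u v) w := by rw [h.br_swap v u]; simp
  have k4 := hb.symm (br v w) u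
  have k5 := hb.symm (br u w) v
  have k6 := hb.symm x u
  have k7 := hb.symm x' v
  have k8 := hb.symm x'' u
  have k9 := hb.symm x w
  linarith

end IsLieFrameAt
end LocalFrame

/-! ### Derivatives of forms in a moving frame -/

section LocalForms

variable {E : Type*} [NormedAddCommGroup E] [NormedSpace ℝ E]
  {V : Type*} [NormedAddCommGroup V] [NormedSpace ℝ V]
  {F : Type*} [NormedAddCommGroup F] [NormedSpace ℝ F] {p : ℕ}
  {ι : Type*} [Fintype ι] [DecidableEq ι]

set_option synthInstance.maxHeartbeats 200000 in
theorem covDeriv_add (g : E → E →L[ℝ] E →L[ℝ] ℝ) (θ : E → E [⋀^Fin p]→L[ℝ] F)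
    (y u u' : E) : covDeriv g θ y (u + u') = covDeriv g θ y u + covDeriv g θ y u' := by
  have : christoffel g y (u + u') = christoffel g y u + christoffel g y u' := by
    rw [christoffel, christoffel, christoffel, ← ContinuousLinearMap.comp_add]
    congr 1
    ext v w
    simp only [map_add, add_apply, sub_apply, smul_apply, ContinuousLinearMap.flip_apply,
      smul_eq_mul]
    ring
  ext v
  simp [covDeriv, derivAction_apply, this, Finset.sum_add_distrib]
  abel

set_option synthInstance.maxHeartbeats 200000 in
theorem covDeriv_smul (g : E → E →L[ℝ] E →L[ℝ] ℝ) (θ : E → E [⋀^Fin p]→L[ℝ] F)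
    (y u : E) (r : ℝ) : covDeriv g θ y (r • u) = r • covDeriv g θ y u := by
  have : christoffel g y (r • u) = r • christoffel g y u := by
    rw [christoffel, christoffel, ← ContinuousLinearMap.comp_smul]
    congr 1
    ext v w
    simp only [map_smul, add_apply, sub_apply, smul_apply, ContinuousLinearMap.flip_apply,
      smul_eq_mul]
    ring
  ext v
  simp [covDeriv, derivAction_apply, this, smul_sub, Finset.smul_sum]

theorem extDeriv_zeroForm_apply {θ : E → E [⋀^Fin 0]→L[ℝ] F} {y : E}
    (hθ : DifferentiableAt ℝ θ y) (w : Fin 1 → E) :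
    extDeriv θ y w = fderiv ℝ (fun z => θ z ![]) y (w 0) := by
  rw [extDeriv_apply hθ]
  simp [Subsingleton.elim (Fin.tail w) ![]]

namespace IsLieFrameAt

variable {g : E → E →L[ℝ] E →L[ℝ] ℝ} {L : E → V →L[ℝ] E} {B : V →L[ℝ] V →L[ℝ] ℝ}
  {br : V →L[ℝ] V →L[ℝ] V} {y : E} {s : ℝ} {b : Module.Basis ι ℝ V}

theorem differentiableAt_apply (h : IsLieFrameAt g L B br y) (v : V) :
    DifferentiableAt ℝ (fun z => L z v) y := h.diff.clm_apply (differentiableAt_const v)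

theorem fderiv_apply (h : IsLieFrameAt g L B br y) (v : V) (d : E) :
    fderiv ℝ (fun z => L z v) y d = fderiv ℝ L y d v := by
  rw [fderiv_clm_apply h.diff (differentiableAt_const v)]
  simp

theorem lieBracket_eq (h : IsLieFrameAt g L B br y) (u v : V) :
    VectorField.lieBracket ℝ (fun z => L z u) (fun z => L z v) y = L y (br u v) := by
  rw [VectorField.lieBracket, h.fderiv_apply, h.fderiv_apply, h.bracket]

/-- The exterior derivative of a one-form, in a Lie frame. -/
theorem extDeriv_one (h : IsLieFrameAt g L B br y) {θ : E → E [⋀^Fin 1]→L[ℝ] F}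
    (hθ : DifferentiableAt ℝ θ y) (v : Fin 2 → V) :
    extDeriv θ y (fun i => L y (v i)) =
      fderiv ℝ (fun z => θ z ![L z (v 1)]) y (L y (v 0)) -
      fderiv ℝ (fun z => θ z ![L z (v 0)]) y (L y (v 1)) -
      θ y ![L y (br (v 0) (v 1))] := by
  have := extDeriv_apply_vectorField (V := fun i z => L z (v i)) hθ
    (fun i => h.differentiableAt_apply (v i))
  rw [this]
  have e0 : ∀ z, (Fin.tail fun i => L z (v i)) = ![L z (v 1)] := fun z => by
    funext i; fin_cases i; rfl
  have e1 : ∀ z, ((1 : Fin 2).removeNth fun i => L z (v i)) = ![L z (v 0)] := fun z => by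
    funext i; fin_cases i; rfl
  simp [Fin.sum_univ_succ, e0, e1, h.lieBracket_eq, sub_eq_add_neg]

variable [FiniteDimensional ℝ E]

/-- The covariant derivative of a form in a Lie frame. The derivatives of the frame in the Leibniz
rule cancel against those in `christoffel_eq`. -/
theorem covDeriv_eq (h : IsLieFrameAt g L B br y) (hs : s ≠ 0) (hb : IsOrthoBasis B s b)
    {θ : E → E [⋀^Fin p]→L[ℝ] F} (hθ : DifferentiableAt ℝ θ y) (u : V) (v : Fin p → V) :
    covDeriv g θ y (L y u) (fun i => L y (v i)) =
      fderiv ℝ (fun z => θ z (fun i => L z (v i))) y (L y u) -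
      (1 / 2 : ℝ) • ∑ j, θ y (fun i => L y (Function.update v j (br u (v j)) i)) := by
  rw [covDeriv, ContinuousAlternatingMap.sub_apply, derivAction_apply,
    fderiv_continuousAlternatingMap_apply_apply hθ (fun i => h.differentiableAt_apply (v i)),
    add_sub_assoc, sub_eq_add_neg]
  congr 1
  rw [Finset.smul_sum, ← Finset.sum_sub_distrib, ← Finset.sum_neg_distrib]
  refine Finset.sum_congr rfl fun j _ => ?_
  rw [h.christoffel_eq hs hb, h.fderiv_apply, ContinuousAlternatingMap.map_update_sub,
    map_smul, ContinuousAlternatingMap.map_update_smul]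
  have : (fun i => L y (Function.update v j (br u (v j)) i)) =
      Function.update (fun i => L y (v i)) j (L y (br u (v j))) := by
    funext i
    by_cases hi : i = j
    · subst hi; simp
    · simp [hi]
  rw [this]
  abel

/-- The codifferential of a form in a Lie frame. -/
theorem coordCodiff_eq (h : IsLieFrameAt g L B br y) (hs : s ≠ 0) (hb : IsOrthoBasis B s b)
    {θ : E → E [⋀^Fin (p + 1)]→L[ℝ] F} (hθ : DifferentiableAt ℝ θ y) (v : Fin p → V) :
    coordCodiff g θ y (fun i => L y (v i)) =
      - s⁻¹ • ∑ k,
      (fderiv ℝ (fun z => θ z (fun i => L z (Matrix.vecCons (b k) v i))) y (L y (b k)) -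
      (1 / 2 : ℝ) • ∑ j, θ y (fun i => L y (Function.update (Matrix.vecCons (b k) v) j
        (br (b k) (Matrix.vecCons (b k) v j)) i))) := by
  obtain ⟨e, he⟩ := h.inv
  set c : Module.Basis ι ℝ E := b.map e.toLinearEquiv with hc
  have hck : ∀ k, c k = L y (b k) := fun k => by simp [hc, ← he]
  have key : coordCodiff g θ y (fun i => L y (v i)) =
      - ∑ i, covDeriv g θ y (Module.finBasis ℝ E i) (Matrix.vecCons ((g y).inverse
        (LinearMap.toContinuousLinearMap ((Module.finBasis ℝ E).coord i)))
        (fun i => L y (v i))) := by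
    simp [coordCodiff]
  -- the contraction may be computed in the basis `c` of frame vectors, whose dual basis has the
  -- `g`-duals `s⁻¹ • c k`
  let T : E →ₗ[ℝ] E →ₗ[ℝ] F := LinearMap.mk₂ ℝ
    (fun a c => covDeriv g θ y a (Matrix.vecCons c (fun i => L y (v i))))
    (fun a a' c => by rw [covDeriv_add]; rfl)
    (fun r a c => by rw [covDeriv_smul]; rfl)
    (fun a c c' => 
      DFunLike.congr_fun (map_add (covDeriv g θ y a).curryLeft c c') (fun i => L y (v i)))
    (fun r a c => 
      DFunLike.congr_fun (map_smul (covDeriv g θ y a).curryLeft r c) (fun i => L y (v i)))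
  have hT := sum_basis_dual_eq (Module.finBasis ℝ E) c T
    ((g y).inverse.toLinearMap ∘ₗ LinearMap.toContinuousLinearMap.toLinearMap)
  have hd : ∀ k, (g y).inverse (LinearMap.toContinuousLinearMap (c.coord k)) =
      s⁻¹ • L y (b k) := fun k => by
    rw [← map_smul]
    refine h.metric_inverse hs hb fun w => ?_
    have : b.repr w k = c.coord k (L y w) := by
      simp [hc, ← he]
    rw [map_smul, smul_apply, hb.apply_left, this, smul_eq_mul, inv_mul_cancel_left₀ hs]
    rfl
  rw [key, neg_smul, Finset.smul_sum]
  congr 1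
  refine hT.trans (Finset.sum_congr rfl fun k _ => ?_)
  have : ((g y).inverse.toLinearMap ∘ₗ LinearMap.toContinuousLinearMap.toLinearMap) (c.coord k) =
    s⁻¹ • L y (b k) := hd k
  rw [this, map_smul, hck]
  congr 1
  rw [← h.covDeriv_eq hs hb hθ]
  change covDeriv g θ y (L y (b k)) _ = _
  congr 1
  funext i
  cases i using Fin.cases <;> rfl

end IsLieFrameAt
end LocalForms

/-! ### Smooth families of alternating maps -/

section AlternatingSmooth

variable {X : Type*} [NormedAddCommGroup X] [NormedSpace ℝ X]
  {V : Type*} [NormedAddCommGroup V] [NormedSpace ℝ V] [FiniteDimensional ℝ V]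
  {F : Type*} [NormedAddCommGroup F] [NormedSpace ℝ F] [FiniteDimensional ℝ F] {p : ℕ}

/-- A family of alternating maps on a finite dimensional space is smooth if all its values are. -/
theorem contDiffOn_alternating {n : ℕ∞ω} {s : Set X} {θ : X → V [⋀^Fin p]→L[ℝ] F}
    (h : ∀ v, ContDiffOn ℝ n (fun x => θ x v) s) : ContDiffOn ℝ n θ s := by
  let b := Module.finBasis ℝ V
  let ev : (V [⋀^Fin p]→L[ℝ] F) →ₗ[ℝ] ((Fin p → Fin (Module.finrank ℝ V)) → F) :=
    { toFun := fun φ k => φ (fun i => b (k i))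
      map_add' := fun _ _ => rfl
      map_smul' := fun _ _ => rfl }
  have hev : LinearMap.ker ev = ⊥ := by
    refine LinearMap.ker_eq_bot.2 fun φ ψ hφ => ?_
    refine ContinuousAlternatingMap.toAlternatingMap_injective ?_
    refine Module.Basis.ext_alternating b fun k _ => ?_
    exact congrFun hφ k
  obtain ⟨r, hr⟩ := ev.exists_leftInverse_of_injective hev
  have : θ = fun x => r.toContinuousLinearMap (ev (θ x)) := by
    funext x
    exact (LinearMap.congr_fun hr (θ x)).symm
  rw [this]
  refine r.toContinuousLinearMap.contDiff.comp_contDiffOn ?_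
  exact contDiffOn_pi.2 fun k => h _

end AlternatingSmooth

/-! ### Lie frames on manifolds -/

section ManifoldFrame

variable {E : Type*} [NormedAddCommGroup E] [NormedSpace ℝ E]
  {H : Type*} [TopologicalSpace H] {I : ModelWithCorners ℝ E H}
  {M : Type*} [TopologicalSpace M] [ChartedSpace H M]
  {V : Type*} [NormedAddCommGroup V] [NormedSpace ℝ V]
  {F : Type*} [NormedAddCommGroup F] [NormedSpace ℝ F] {p : ℕ}

/-- The coordinate expression of a frame `e` (with model space `V`) in the chart of `M` at `x`. -/
def frameInChart (e : (x : M) → V →L[ℝ] TangentSpace I x) (x : M) (y : E) : V →L[ℝ] E :=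
  (mfderiv I 𝓘(ℝ, E) (extChartAt I x) ((extChartAt I x).symm y)) ∘L e ((extChartAt I x).symm y)

/-- A frame `e` of `TM` with the infinitesimal properties of the left invariant fields on a Lie
group with bi-invariant metric: the inner products are constant, equal to `B`, and the Lie brackets
are given by a bracket `br` on `V` for which `B` is invariant. The bracket at `x` is computed in the
chart at `x`. -/
structure IsLieFrame (g : BilinField I M) (e : (x : M) → V →L[ℝ] TangentSpace I x)
    (B : V →L[ℝ] V →L[ℝ] ℝ) (br : V →L[ℝ] V →L[ℝ] V) : Prop where
  inv : ∀ x, (e x).IsInvertible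
  smooth : ∀ x, ContDiffOn ℝ ∞ (frameInChart e x) (extChartAt I x).target
  metric : ∀ x v w, g x (e x v) (e x w) = B v w
  bracket : ∀ x u v, fderiv ℝ (frameInChart e x) (extChartAt I x x)
      (frameInChart e x (extChartAt I x x) u) v - fderiv ℝ (frameInChart e x) (extChartAt I x x)
      (frameInChart e x (extChartAt I x x) v) u = frameInChart e x (extChartAt I x x) (br u v)
  skew : ∀ u v w, B (br u v) w = - B v (br u w)

/-- The coefficient functions of a form in a frame. -/
def coeff (e : (x : M) → V →L[ℝ] TangentSpace I x) (θ : DiffForm I M p F) (v : Fin p → V) (x : M) :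
    F := θ x (fun i => e x (v i))

variable (I) in
/-- Smoothness of a function on a manifold without boundary, in terms of the preferred charts. -/
def IsSmoothFun (f : M → F) : Prop :=
  ∀ x : M, ContDiffOn ℝ ∞ (f ∘ (extChartAt I x).symm) (extChartAt I x).target

/-- The derivative of a function along the vector field `e · v`. -/
def frameDeriv (e : (x : M) → V →L[ℝ] TangentSpace I x) (v : V) (f : M → F) (x : M) : F :=
  fderiv ℝ (f ∘ (extChartAt I x).symm) (extChartAt I x x) (frameInChart e x (extChartAt I x x) v)

theorem coeff_sub_apply (e : (x : M) → V →L[ℝ] TangentSpace I x) (θ η : DiffForm I M p F)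
    (v : Fin p → V) (x : M) : coeff e (θ - η) v x = coeff e θ v x - coeff e η v x := rfl

variable [IsManifold I 1 M]

/-- At the centre of a chart, the differential of the chart is the identity. -/
theorem frameInChart_self (e : (x : M) → V →L[ℝ] TangentSpace I x) (x : M) :
    frameInChart e x (extChartAt I x x) = e x := by
  have : ∀ z, z = x → ∀ v, (mfderiv I 𝓘(ℝ, E) (extChartAt I x) z (e z v) : E) = (e x v : E) := by
    rintro _ rfl v
    rw [mfderiv_extChartAt_self]
    rfl
  ext v
  exact this _ (extChartAt_to_inv x) v

theorem pullback_extChartAt_self (η : E → E [⋀^Fin p]→L[ℝ] F) (x : M)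
    (e : (x : M) → V →L[ℝ] TangentSpace I x) (v : Fin p → V) :
    (pullback I 𝓘(ℝ, E) (extChartAt I x) η x) (fun i => e x (v i)) =
      η (extChartAt I x x) (fun i => frameInChart e x (extChartAt I x x) (v i)) := by
  rw [frameInChart_self]
  change η (extChartAt I x x) _ = _
  rw [mfderiv_extChartAt_self]
  rfl

theorem isInvertible_frameInChart {e : (x : M) → V →L[ℝ] TangentSpace I x}
    (he : ∀ x, (e x).IsInvertible) (x : M) {y : E} (hy : y ∈ (extChartAt I x).target) :
    (frameInChart e x y).IsInvertible :=
  (isInvertible_mfderiv_extChartAt ((extChartAt I x).map_target hy)).comp (he _)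

variable [I.Boundaryless]

theorem mfderiv_extChartAt_symm_comp (x : M) {y : E} (hy : y ∈ (extChartAt I x).target)
    (w : TangentSpace I ((extChartAt I x).symm y)) :
    mfderiv 𝓘(ℝ, E) I (extChartAt I x).symm y
      (mfderiv I 𝓘(ℝ, E) (extChartAt I x) ((extChartAt I x).symm y) w) = w := by
  have := mfderivWithin_extChartAt_symm_comp_mfderiv_extChartAt hy
  rw [I.range_eq_univ, mfderivWithin_univ] at this
  exact DFunLike.congr_fun this w

theorem inChart_apply_frame (e : (x : M) → V →L[ℝ] TangentSpace I x) (θ : DiffForm I M p F) (x : M)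
    {y : E} (hy : y ∈ (extChartAt I x).target) (v : Fin p → V) :
    inChart θ x y (fun i => frameInChart e x y (v i)) = coeff e θ v ((extChartAt I x).symm y) := by
  change θ ((extChartAt I x).symm y) _ = θ _ _
  congr 1
  funext i
  exact mfderiv_extChartAt_symm_comp x hy (e _ (v i))

theorem metricInChart_apply_frame (e : (x : M) → V →L[ℝ] TangentSpace I x) (g : BilinField I M)
    (x : M) {y : E} (hy : y ∈ (extChartAt I x).target) (v w : V) :
    metricInChart g x y (frameInChart e x y v) (frameInChart e x y w) =
      g ((extChartAt I x).symm y) (e _ v) (e _ w) := by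
  have h := fun v => mfderiv_extChartAt_symm_comp x hy (e _ v)
  change g ((extChartAt I x).symm y) (mfderiv 𝓘(ℝ, E) I (extChartAt I x).symm y _)
    (mfderiv 𝓘(ℝ, E) I (extChartAt I x).symm y _) = _
  erw [h v, h w]

namespace IsLieFrame

variable {g : BilinField I M} {e : (x : M) → V →L[ℝ] TangentSpace I x}
  {B : V →L[ℝ] V →L[ℝ] ℝ} {br : V →L[ℝ] V →L[ℝ] V}

theorem isLieFrameAt (h : IsLieFrame g e B br) (x : M) :
    IsLieFrameAt (metricInChart g x) (frameInChart e x) B br (extChartAt I x x) where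
  inv := isInvertible_frameInChart h.inv x (mem_extChartAt_target x)
  diff := ((h.smooth x).contDiffAt (extChartAt_target_mem_nhds x)).differentiableAt (by simp)
  metric := by
    filter_upwards [extChartAt_target_mem_nhds (I := I) x] with y hy v w
    rw [metricInChart_apply_frame e g x hy, h.metric]
  bracket := h.bracket x
  skew := h.skew

theorem fderiv_inChart_apply (θ : DiffForm I M p F) (x : M) (v : Fin p → V) (u : V) :
    fderiv ℝ (fun z => inChart θ x z (fun i => frameInChart e x z (v i))) (extChartAt I x x)
      (frameInChart e x (extChartAt I x x) u) = frameDeriv e u (coeff e θ v) x := by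
  rw [frameDeriv]
  congr 1
  refine Filter.EventuallyEq.fderiv_eq ?_
  filter_upwards [extChartAt_target_mem_nhds (I := I) x] with y hy
  exact inChart_apply_frame e θ x hy v

theorem inChart_apply_frame_self (θ : DiffForm I M p F) (x : M) (v : Fin p → V) :
    inChart θ x (extChartAt I x x) (fun i => frameInChart e x (extChartAt I x x) (v i)) =
      coeff e θ v x := by
  rw [inChart_apply_frame e θ x (mem_extChartAt_target x), extChartAt_to_inv]

/-- A form is smooth if its coefficients in a Lie frame are. -/
theorem isSmooth_of_coeff [FiniteDimensional ℝ E] [FiniteDimensional ℝ F]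
    (h : IsLieFrame g e B br) {θ : DiffForm I M p F}
    (hθ : ∀ v, IsSmoothFun I (coeff e θ v)) : IsSmooth θ := by
  intro x
  have : CompleteSpace E := FiniteDimensional.complete ℝ E
  obtain ⟨e₀, -⟩ : (frameInChart e x (extChartAt I x x)).IsInvertible :=
    isInvertible_frameInChart h.inv x (mem_extChartAt_target x)
  have : FiniteDimensional ℝ V := e₀.symm.toLinearEquiv.finiteDimensional
  have : CompleteSpace V := FiniteDimensional.complete ℝ V
  let b := Module.finBasis ℝ V
  refine contDiffOn_alternating fun w => ?_
  -- expand the vectors `w j` in the frame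
  have hexp : ∀ y ∈ (extChartAt I x).target, inChart θ x y w =
      ∑ k : Fin p → Fin (Module.finrank ℝ V),
      (∏ j, b.repr ((frameInChart e x y).inverse (w j)) (k j)) •
        coeff e θ (fun j => b (k j)) ((extChartAt I x).symm y) := by
    intro y hy
    obtain ⟨a, ha⟩ := isInvertible_frameInChart h.inv x hy
    have hw : w = fun j => ∑ i, b.repr ((frameInChart e x y).inverse (w j)) i •
        frameInChart e x y (b i) := by
      funext j
      simp only [← map_smul, ← map_sum, b.sum_repr]
      rw [← ha]
      simp
    conv_lhs => rw [hw]
    rw [← ContinuousAlternatingMap.coe_toContinuousMultilinearMap, ContinuousMultilinearMap.map_sum]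
    refine Finset.sum_congr rfl fun k _ => ?_
    rw [ContinuousMultilinearMap.map_smul_univ]
    congr 1
    exact inChart_apply_frame e θ x hy _
  refine ContDiffOn.congr ?_ hexp
  refine ContDiffOn.sum fun k _ => ContDiffOn.smul (contDiffOn_prod fun j _ => ?_) (hθ _ x)
  have hinv : ContDiffOn ℝ ∞ (fun y => (frameInChart e x y).inverse) (extChartAt I x).target := by
    intro y hy
    obtain ⟨a, ha⟩ := isInvertible_frameInChart h.inv x hy
    have := contDiffAt_map_inverse (𝕜 := ℝ) (n := ∞) a
    rw [ha] at this
    exact this.comp_contDiffWithinAt y (h.smooth x y hy)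
  exact (b.coord (k j)).toContinuousLinearMap.contDiff.comp_contDiffOn
    (hinv.clm_apply contDiffOn_const)

variable [FiniteDimensional ℝ E] [FiniteDimensional ℝ F]

theorem differentiableAt_inChart (h : IsLieFrame g e B br) {θ : DiffForm I M p F}
    (hθ : ∀ v, IsSmoothFun I (coeff e θ v)) (x : M) :
    DifferentiableAt ℝ (inChart θ x) (extChartAt I x x) :=
  ((h.isSmooth_of_coeff hθ x).contDiffAt (extChartAt_target_mem_nhds x)).differentiableAt (by simp)

/-- The differential of a function in a Lie frame. -/
theorem coeff_extD_zero (h : IsLieFrame g e B br) {θ : DiffForm I M 0 F}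
    (hθ : ∀ v, IsSmoothFun I (coeff e θ v)) (v : Fin 1 → V) (x : M) :
    coeff e (extD θ) v x = frameDeriv e (v 0) (coeff e θ ![]) x := by
  rw [coeff, extD, pullback_extChartAt_self,
    extDeriv_zeroForm_apply (h.differentiableAt_inChart hθ x), ← fderiv_inChart_apply]
  congr 3
  funext z
  exact congrArg _ (Subsingleton.elim _ _)

/-- The exterior derivative of a one-form in a Lie frame. -/
theorem coeff_extD_one (h : IsLieFrame g e B br) {θ : DiffForm I M 1 F}
    (hθ : ∀ v, IsSmoothFun I (coeff e θ v)) (v : Fin 2 → V) (x : M) :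
    coeff e (extD θ) v x = frameDeriv e (v 0) (coeff e θ ![v 1]) x -
      frameDeriv e (v 1) (coeff e θ ![v 0]) x - coeff e θ ![br (v 0) (v 1)] x := by
  have hv : ∀ (z : E) (u : V), ![frameInChart e x z u] = fun i => frameInChart e x z (![u] i) :=
    fun z u => by funext i; fin_cases i; rfl
  rw [coeff, extD, pullback_extChartAt_self,
    (h.isLieFrameAt x).extDeriv_one (h.differentiableAt_inChart hθ x)]
  simp only [hv, fderiv_inChart_apply, inChart_apply_frame_self]

/-- The codifferential of a form in a Lie frame: the formula does not refer to charts. -/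
theorem coeff_codiff {ι : Type*} [Fintype ι] [DecidableEq ι] {b : Module.Basis ι ℝ V} {s : ℝ}
    (h : IsLieFrame g e B br) (hs : s ≠ 0) (hb : IsOrthoBasis B s b)
    {θ : DiffForm I M (p + 1) F}
    (hθ : ∀ v, IsSmoothFun I (coeff e θ v)) (v : Fin p → V) (x : M) :
    coeff e (codiff g θ) v x = - s⁻¹ • ∑ k,
      (frameDeriv e (b k) (coeff e θ (Matrix.vecCons (b k) v)) x -
      (1 / 2 : ℝ) • ∑ j, coeff e θ (Function.update (Matrix.vecCons (b k) v) j
        (br (b k) (Matrix.vecCons (b k) v j))) x) := by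
  rw [coeff, codiff, pullback_extChartAt_self,
    (h.isLieFrameAt x).coordCodiff_eq hs hb (h.differentiableAt_inChart hθ x)]
  simp only [fderiv_inChart_apply, inChart_apply_frame_self]

end IsLieFrame

end ManifoldFrame

/-! ### The Laplacian of one-forms in a Lie frame -/

section FrameLaplacian

variable {E : Type*} [NormedAddCommGroup E] [NormedSpace ℝ E]
  {H : Type*} [TopologicalSpace H] {I : ModelWithCorners ℝ E H}
  {M : Type*} [TopologicalSpace M] [ChartedSpace H M]
  {V : Type*} [NormedAddCommGroup V] [NormedSpace ℝ V]
  {F : Type*} [NormedAddCommGroup F] [NormedSpace ℝ F] {p : ℕ}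
  {g : BilinField I M} {e : (x : M) → V →L[ℝ] TangentSpace I x}
  {B : V →L[ℝ] V →L[ℝ] ℝ} {br : V →L[ℝ] V →L[ℝ] V}

theorem ext_of_coeff (he : ∀ x, (e x).IsInvertible) {θ η : DiffForm I M p F}
    (h : ∀ v x, coeff e θ v x = coeff e η v x) : θ = η := by
  funext x
  ext w
  obtain ⟨a, ha⟩ := he x
  have := h (fun i => a.symm (w i)) x
  simpa [coeff, ← ha] using this

theorem isSmoothFun_const (c : F) : IsSmoothFun I (fun _ : M => c) := fun _ => contDiffOn_const

theorem frameDeriv_const (v : V) (c : F) (x : M) : frameDeriv e v (fun _ : M => c) x = 0 := by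
  rw [frameDeriv]
  change fderiv ℝ (fun _ => c) _ _ = 0
  simp

variable [IsManifold I 1 M] [I.Boundaryless]

theorem IsLieFrame.br_self [Nonempty M] (h : IsLieFrame g e B br) (v : V) : br v v = 0 := by
  have := (h.isLieFrameAt (Classical.arbitrary M)).br_swap v v
  have h2 : (2 : ℝ) • br v v = 0 := by rw [two_smul]; exact eq_neg_iff_add_eq_zero.1 this
  exact (smul_eq_zero.1 h2).resolve_left two_ne_zero

variable [FiniteDimensional ℝ E] [FiniteDimensional ℝ F]
  {ι : Type*} [Fintype ι] [DecidableEq ι] {b : Module.Basis ι ℝ V} {s : ℝ}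

theorem IsLieFrame.extD_zero (h : IsLieFrame g e B br) : extD (0 : DiffForm I M 0 F) = 0 := by
  have hc : ∀ v, coeff e (0 : DiffForm I M 0 F) v = fun _ => 0 := fun v => rfl
  refine ext_of_coeff h.inv fun v x => ?_
  rw [h.coeff_extD_zero fun v => by rw [hc]; exact isSmoothFun_const _, hc, frameDeriv_const]
  rfl

/-- The divergence of a one-form in a Lie frame. -/
theorem IsLieFrame.coeff_codiff_one (h : IsLieFrame g e B br) (hs : s ≠ 0) (hb : IsOrthoBasis B s b)
    {θ : DiffForm I M 1 F} (hθ : ∀ v, IsSmoothFun I (coeff e θ v)) (v : Fin 0 → V) (x : M) :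
    coeff e (codiff g θ) v x = - s⁻¹ • ∑ k, frameDeriv e (b k) (coeff e θ ![b k]) x := by
  have : Nonempty M := ⟨x⟩
  rw [h.coeff_codiff hs hb hθ, Subsingleton.elim v ![]]
  congr 1
  refine Finset.sum_congr rfl fun k _ => ?_
  rw [sub_eq_self, Finset.sum_eq_zero, smul_zero]
  intro j _
  refine (θ x).map_coord_zero j ?_
  fin_cases j
  simp [h.br_self]

theorem IsLieFrame.coeff_codiff_two (h : IsLieFrame g e B br) (hs : s ≠ 0) (hb : IsOrthoBasis B s b)
    {θ : DiffForm I M 2 F} (hθ : ∀ v, IsSmoothFun I (coeff e θ v)) (v : Fin 1 → V) (x : M) :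
    coeff e (codiff g θ) v x = - s⁻¹ • ∑ k, (frameDeriv e (b k) (coeff e θ ![b k, v 0]) x -
      (1 / 2 : ℝ) • coeff e θ ![b k, br (b k) (v 0)] x) := by
  have : Nonempty M := ⟨x⟩
  have hv : ∀ k, Matrix.vecCons (b k) v = ![b k, v 0] := fun k => by
    funext i; fin_cases i <;> rfl
  rw [h.coeff_codiff hs hb hθ]
  simp only [hv]
  congr 1
  refine Finset.sum_congr rfl fun k _ => ?_
  congr 2
  rw [Fin.sum_univ_two]
  have h0 : coeff e θ (Function.update ![b k, v 0] 0 (br (b k) (![b k, v 0] 0))) x = 0 := by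
    refine (θ x).map_coord_zero 0 ?_
    simp [h.br_self]
  rw [h0, zero_add]
  congr 1
  funext i; fin_cases i <;> rfl

/-- The Laplacian of a one-form with vanishing divergence, in a Lie frame. -/
theorem IsLieFrame.coeff_laplacian_one (h : IsLieFrame g e B br) (hs : s ≠ 0)
    (hb : IsOrthoBasis B s b) {θ : DiffForm I M 1 F}
    (hδ : codiff g θ = 0) (hdθ : ∀ v, IsSmoothFun I (coeff e (extD θ) v)) (v : Fin 1 → V) (x : M) :
    coeff e (laplacian g 1 θ) v x =
      - s⁻¹ • ∑ k, (frameDeriv e (b k) (coeff e (extD θ) ![b k, v 0]) x -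
      (1 / 2 : ℝ) • coeff e (extD θ) ![b k, br (b k) (v 0)] x) := by
  rw [← h.coeff_codiff_two hs hb hdθ, laplacian, hδ, h.extD_zero, zero_add]

/-- The Laplacian of a one-form with constant coefficients in a Lie frame. -/
theorem IsLieFrame.coeff_laplacian_of_const (h : IsLieFrame g e B br) (hs : s ≠ 0)
    (hb : IsOrthoBasis B s b) {θ : DiffForm I M 1 F} (β : V → F)
    (hθ : ∀ v, coeff e θ v = fun _ => β (v 0)) (v : Fin 1 → V) (x : M) :
    coeff e (laplacian g 1 θ) v x = - (2 * s)⁻¹ • ∑ k, β (br (b k) (br (b k) (v 0))) := by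
  have hθs : ∀ v, IsSmoothFun I (coeff e θ v) := fun v => by
    rw [hθ]; exact isSmoothFun_const _
  have hd : ∀ v, coeff e (extD θ) v = fun _ => - β (br (v 0) (v 1)) := fun v => by
    funext x
    rw [h.coeff_extD_one hθs]
    simp [hθ, frameDeriv_const]
  have hδ : codiff g θ = 0 := by
    refine ext_of_coeff h.inv fun v x => ?_
    rw [h.coeff_codiff_one hs hb hθs]
    simp [hθ, frameDeriv_const]
    rfl
  rw [h.coeff_laplacian_one hs hb hδ fun v => by rw [hd]; exact isSmoothFun_const _]
  simp [hd, frameDeriv_const, Finset.smul_sum, smul_smul, mul_comm]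

end FrameLaplacian

/-! ### Products of Lie frames -/

section ProductFrame

variable {E : Type*} [NormedAddCommGroup E] [NormedSpace ℝ E]
  {H : Type*} [TopologicalSpace H] {I : ModelWithCorners ℝ E H}
  {M : Type*} [TopologicalSpace M] [ChartedSpace H M]
  {V : Type*} [NormedAddCommGroup V] [NormedSpace ℝ V]
  {F : Type*} [NormedAddCommGroup F] [NormedSpace ℝ F] {p : ℕ}
  {g : BilinField I M} {e : (x : M) → V →L[ℝ] TangentSpace I x}
  {B : V →L[ℝ] V →L[ℝ] ℝ} {br : V →L[ℝ] V →L[ℝ] V}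

/-- The frame `(u, v) ↦ (e u, e v)` on `M × M`. -/
def prodFrame (e : (x : M) → V →L[ℝ] TangentSpace I x) (x : M × M) :
    V × V →L[ℝ] TangentSpace (I.prod I) x :=
  (e x.1).prodMap (e x.2)

/-- The bilinear form `2 (B ⊕ B)` on `V × V`. -/
def doubleForm (B : V →L[ℝ] V →L[ℝ] ℝ) : V × V →L[ℝ] V × V →L[ℝ] ℝ :=
  (2 : ℝ) • (B.bilinearComp (.fst ℝ V V) (.fst ℝ V V) + B.bilinearComp (.snd ℝ V V) (.snd ℝ V V))

/-- The componentwise bracket on `V × V`. -/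
def prodBracket (br : V →L[ℝ] V →L[ℝ] V) : V × V →L[ℝ] V × V →L[ℝ] V × V :=
  ContinuousLinearMap.compL ℝ (V × V) V (V × V) (.inl ℝ V V) ∘L
      br.bilinearComp (.fst ℝ V V) (.fst ℝ V V) +
    ContinuousLinearMap.compL ℝ (V × V) V (V × V) (.inr ℝ V V) ∘L
      br.bilinearComp (.snd ℝ V V) (.snd ℝ V V)

@[simp]
theorem doubleForm_apply (u v : V × V) : doubleForm B u v = 2 * (B u.1 v.1 + B u.2 v.2) := by
  simp [doubleForm]
  ring

@[simp]
theorem prodBracket_apply (u v : V × V) : prodBracket br u v = (br u.1 v.1, br u.2 v.2) := by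
  simp [prodBracket]

theorem isOrthoBasis_doubleForm {ι : Type*} [Fintype ι] [DecidableEq ι] {b : Module.Basis ι ℝ V}
    (hb : IsOrthoBasis B 1 b) : IsOrthoBasis (doubleForm B) 2 (b.prod b) := by
  rintro (i | i) (j | j) <;> simp [hb i j]

theorem isSmoothFun_comp_snd {f : M → F} (hf : IsSmoothFun I f) :
    IsSmoothFun (I.prod I) (fun z : M × M => f z.2) := by
  intro x
  rw [extChartAt_prod]
  exact (hf x.2).comp contDiff_snd.contDiffOn fun z hz => hz.2

variable [IsManifold I 1 M] [I.Boundaryless]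

/-- The differential of a chart as the derivative of a coordinate change. In this form it is
compatible with products, without a change of the model `𝓘(ℝ, E × E)`. -/
theorem mfderiv_extChartAt_eq_fderiv (x : M) {z : M} (hz : z ∈ (extChartAt I x).source) :
    (mfderiv I 𝓘(ℝ, E) (extChartAt I x) z : E →L[ℝ] E) =
      fderiv ℝ (extChartAt I x ∘ (extChartAt I z).symm) (extChartAt I z z) := by
  have : MDifferentiableAt I 𝓘(ℝ, E) (extChartAt I x) z :=
    mdifferentiableAt_extChartAt (by rwa [← extChartAt_source (I := I)])
  rw [this.mfderiv, I.range_eq_univ, fderivWithin_univ]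
  rfl

theorem differentiableAt_extChartAt_comp (x : M) {z : M} (hz : z ∈ (extChartAt I x).source) :
    DifferentiableAt ℝ (extChartAt I x ∘ (extChartAt I z).symm) (extChartAt I z z) := by
  have : MDifferentiableAt I 𝓘(ℝ, E) (extChartAt I x) z :=
    mdifferentiableAt_extChartAt (by rwa [← extChartAt_source (I := I)])
  have := this.differentiableWithinAt_writtenInExtChartAt
  rw [I.range_eq_univ, differentiableWithinAt_univ] at this
  exact this

theorem frameInChart_prodFrame (x y : M) {z w : E} (hz : z ∈ (extChartAt I x).target)
    (hw : w ∈ (extChartAt I y).target) :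
    frameInChart (prodFrame e) (x, y) (z, w) =
      (frameInChart e x z).prodMap (frameInChart e y w) := by
  have hz' := (extChartAt I x).map_target hz
  have hw' := (extChartAt I y).map_target hw
  have h : ∀ a c : M, a ∈ (extChartAt I x).source → c ∈ (extChartAt I y).source →
      (mfderiv (I.prod I) 𝓘(ℝ, E × E) (extChartAt (I.prod I) (x, y)) (a, c) :
        E × E →L[ℝ] E × E) =
      ((mfderiv I 𝓘(ℝ, E) (extChartAt I x) a : E →L[ℝ] E)).prodMap
        (mfderiv I 𝓘(ℝ, E) (extChartAt I y) c : E →L[ℝ] E) := by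
    intro a c ha hc
    have hac : (a, c) ∈ (extChartAt (I.prod I) (x, y)).source := by
      rw [extChartAt_prod]; exact ⟨ha, hc⟩
    rw [mfderiv_extChartAt_eq_fderiv _ hac, mfderiv_extChartAt_eq_fderiv _ ha,
      mfderiv_extChartAt_eq_fderiv _ hc, extChartAt_prod, extChartAt_prod]
    exact (HasFDerivAt.prodMap (extChartAt I a a, extChartAt I c c)
      (differentiableAt_extChartAt_comp x ha).hasFDerivAt
      (differentiableAt_extChartAt_comp y hc).hasFDerivAt).fderiv
  have h' := h _ _ hz' hw'
  unfold frameInChart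
  rw [show (extChartAt (I.prod I) (x, y)).symm (z, w) =
    ((extChartAt I x).symm z, (extChartAt I y).symm w) by rw [extChartAt_prod]; rfl]
  erw [h']
  rfl

/-- The derivative on `M × M` of a function of the second variable. -/
theorem frameDeriv_prodFrame_snd {f : M → F} (hf : IsSmoothFun I f) (v : V × V) (x : M × M) :
    frameDeriv (prodFrame e) v (fun z => f z.2) x = frameDeriv e v.2 f x.2 := by
  have hd : DifferentiableAt ℝ (f ∘ (extChartAt I x.2).symm) (extChartAt I x.2 x.2) :=
    ((hf x.2).contDiffAt (extChartAt_target_mem_nhds x.2)).differentiableAt (by simp)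
  have hx : extChartAt (I.prod I) x x = (extChartAt I x.1 x.1, extChartAt I x.2 x.2) := by
    rw [extChartAt_prod]; rfl
  have hF : (fun z : M × M => f z.2) ∘ (extChartAt (I.prod I) x).symm =
      (f ∘ (extChartAt I x.2).symm) ∘ Prod.snd := by
    rw [extChartAt_prod]; rfl
  have hd' : HasFDerivAt ((f ∘ (extChartAt I x.2).symm) ∘ Prod.snd) _
      (extChartAt I x.1 x.1, extChartAt I x.2 x.2) :=
    HasFDerivAt.comp _ hd.hasFDerivAt hasFDerivAt_snd
  rw [frameDeriv, hF, hx, hd'.fderiv, frameDeriv, frameInChart_prodFrame (x := x.1) (y := x.2)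
    (mem_extChartAt_target _) (mem_extChartAt_target _)]
  rfl

/-- The product of two copies of a Lie frame is a Lie frame for the metric `2 (g ⊕ g)`. -/
theorem IsLieFrame.prod (h : IsLieFrame g e B br) :
    IsLieFrame (doubleMetric g) (prodFrame e) (doubleForm B) (prodBracket br) where
  inv x := by
    obtain ⟨a, ha⟩ := h.inv x.1
    obtain ⟨c, hc⟩ := h.inv x.2
    exact ⟨a.prodCongr c, by rw [prodFrame, ← ha, ← hc]; rfl⟩
  smooth x := by
    have h1 : ContDiffOn ℝ ∞ (fun z : E × E => frameInChart e x.1 z.1)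
        (extChartAt (I.prod I) x).target := by
      rw [extChartAt_prod]
      exact (h.smooth x.1).comp contDiff_fst.contDiffOn fun z hz => hz.1
    have h2 : ContDiffOn ℝ ∞ (fun z : E × E => frameInChart e x.2 z.2)
        (extChartAt (I.prod I) x).target := by
      rw [extChartAt_prod]
      exact (h.smooth x.2).comp contDiff_snd.contDiffOn fun z hz => hz.2
    refine ContDiffOn.congr ((ContinuousLinearMap.prodMapL ℝ V E V E).contDiff.comp_contDiffOn
      (h1.prodMk h2)) fun z hz => ?_
    rw [extChartAt_prod] at hz
    exact frameInChart_prodFrame x.1 x.2 hz.1 hz.2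
  metric x u v := by
    have : doubleMetric g x (prodFrame e x u) (prodFrame e x v) =
      2 * (g x.1 (mfderiv (I.prod I) I Prod.fst x (prodFrame e x u))
          (mfderiv (I.prod I) I Prod.fst x (prodFrame e x v)) +
        g x.2 (mfderiv (I.prod I) I Prod.snd x (prodFrame e x u))
          (mfderiv (I.prod I) I Prod.snd x (prodFrame e x v))) := rfl
    rw [this, mfderiv_fst, mfderiv_snd, doubleForm_apply, ← h.metric x.1, ← h.metric x.2]
    rfl
  bracket x u v := by
    have hx : extChartAt (I.prod I) x x = (extChartAt I x.1 x.1, extChartAt I x.2 x.2) := by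
      rw [extChartAt_prod]; rfl
    have h1 := (h.isLieFrameAt x.1)
    have h2 := (h.isLieFrameAt x.2)
    have hL : frameInChart (prodFrame e) x =ᶠ[nhds (extChartAt (I.prod I) x x)] fun z =>
        ContinuousLinearMap.prodMapL ℝ V E V E
          (frameInChart e x.1 z.1, frameInChart e x.2 z.2) := by
      filter_upwards [extChartAt_target_mem_nhds (I := I.prod I) x] with z hz
      rw [extChartAt_prod] at hz
      exact frameInChart_prodFrame x.1 x.2 hz.1 hz.2
    set P : E × E := (extChartAt I x.1 x.1, extChartAt I x.2 x.2)
    have k1 : HasFDerivAt (fun z : E × E => frameInChart e x.1 z.1) _ P :=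
      HasFDerivAt.comp (g := frameInChart e x.1) (f := Prod.fst) P h1.diff.hasFDerivAt
        hasFDerivAt_fst
    have k2 : HasFDerivAt (fun z : E × E => frameInChart e x.2 z.2) _ P :=
      HasFDerivAt.comp (g := frameInChart e x.2) (f := Prod.snd) P h2.diff.hasFDerivAt
        hasFDerivAt_snd
    have hd : HasFDerivAt (fun z : E × E => ContinuousLinearMap.prodMapL ℝ V E V E
        (frameInChart e x.1 z.1, frameInChart e x.2 z.2)) _ P :=
      HasFDerivAt.comp P (ContinuousLinearMap.prodMapL ℝ V E V E).hasFDerivAt (k1.prodMk k2)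
    rw [hL.fderiv_eq, hL.self_of_nhds, hx, hd.fderiv, prodBracket_apply]
    exact Prod.ext (h1.bracket u.1 v.1) (h2.bracket u.2 v.2)
  skew u v w := by
    simp [h.skew u.1, h.skew u.2]
    ring

end ProductFrame

/-! ### Second derivatives and brackets on a normed space -/

section Calculus

variable {E : Type*} [NormedAddCommGroup E] [NormedSpace ℝ E]
  {V : Type*} [NormedAddCommGroup V] [NormedSpace ℝ V]

/-- Mixed partial derivatives of a map of two variables commute. -/
theorem fderiv_partial_comm {Φ : E × E → E} {a b : E} (h : ContDiffAt ℝ 2 Φ (a, b)) (u v : E) :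
    fderiv ℝ (fun t => fderiv ℝ (fun s => Φ (s, t)) a v) b u =
      fderiv ℝ (fun s => fderiv ℝ (fun t => Φ (s, t)) b u) a v := by
  have hd : ∀ᶠ p in nhds (a, b), DifferentiableAt ℝ Φ p := by
    filter_upwards [h.eventually (by simp)] with p hp
    exact hp.differentiableAt two_ne_zero
  have h2 : DifferentiableAt ℝ (fderiv ℝ Φ) (a, b) :=
    (h.fderiv_right (m := 1) le_rfl).differentiableAt one_ne_zero
  have e1 : (fun t => fderiv ℝ (fun s => Φ (s, t)) a v) =ᶠ[nhds b]
      fun t => fderiv ℝ Φ (a, t) (v, 0) := by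
    have : Filter.Tendsto (fun t : E => (a, t)) (nhds b) (nhds (a, b)) :=
      (Continuous.prodMk_right a).tendsto b
    filter_upwards [this.eventually hd] with t ht
    have : HasFDerivAt (fun s => Φ (s, t)) _ a :=
      HasFDerivAt.comp (f := fun s => (s, t)) a ht.hasFDerivAt (hasFDerivAt_prodMk_left a t)
    rw [this.fderiv]
    rfl
  have e2 : (fun s => fderiv ℝ (fun t => Φ (s, t)) b u) =ᶠ[nhds a]
      fun s => fderiv ℝ Φ (s, b) (0, u) := by
    have : Filter.Tendsto (fun s : E => (s, b)) (nhds a) (nhds (a, b)) :=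
      (Continuous.prodMk_left b).tendsto a
    filter_upwards [this.eventually hd] with t ht
    have : HasFDerivAt (fun s => Φ (t, s)) _ b :=
      HasFDerivAt.comp (f := fun s => (t, s)) b ht.hasFDerivAt (hasFDerivAt_prodMk_right t b)
    rw [this.fderiv]
    rfl
  have d1 : HasFDerivAt (fun t => fderiv ℝ Φ (a, t) (v, 0)) _ b :=
    (HasFDerivAt.comp (f := fun t => (a, t)) b h2.hasFDerivAt
      (hasFDerivAt_prodMk_right a b)).clm_apply (hasFDerivAt_const _ _)
  have d2 : HasFDerivAt (fun s => fderiv ℝ Φ (s, b) (0, u)) _ a :=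
    (HasFDerivAt.comp (f := fun s => (s, b)) a h2.hasFDerivAt
      (hasFDerivAt_prodMk_left a b)).clm_apply (hasFDerivAt_const _ _)
  rw [e1.fderiv_eq, e2.fderiv_eq, d1.fderiv, d2.fderiv]
  have := (h.isSymmSndFDerivAt (by simp)).eq (0, u) (v, 0)
  simpa using this

/-- Naturality of the Lie bracket: if `f` intertwines the frames `L` and `L'` up to `T`, it
intertwines their brackets. -/
theorem bracket_natural {L L' : E → V →L[ℝ] E} {T : V →L[ℝ] V} {f : E → E} {y : E}
    (hf : ContDiffAt ℝ 2 f y) (hL : DifferentiableAt ℝ L y) (hL' : DifferentiableAt ℝ L' (f y))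
    (h : ∀ᶠ z in nhds y, ∀ v, fderiv ℝ f z (L z v) = L' (f z) (T v)) (u v : V) :
    fderiv ℝ f y (fderiv ℝ L y (L y u) v - fderiv ℝ L y (L y v) u) =
      fderiv ℝ L' (f y) (L' (f y) (T u)) (T v) - fderiv ℝ L' (f y) (L' (f y) (T v)) (T u) := by
  have h2 : DifferentiableAt ℝ (fderiv ℝ f) y :=
    (hf.fderiv_right (m := 1) le_rfl).differentiableAt one_ne_zero
  have hfd := (hf.differentiableAt two_ne_zero)
  have key : ∀ u v, fderiv ℝ (fderiv ℝ f) y (L y u) (L y v) +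
      fderiv ℝ f y (fderiv ℝ L y (L y u) v) = fderiv ℝ L' (f y) (L' (f y) (T u)) (T v) := by
    intro u v
    have d1 : HasFDerivAt (fun z => fderiv ℝ f z (L z v)) _ y :=
      h2.hasFDerivAt.clm_apply (hL.hasFDerivAt.clm_apply (hasFDerivAt_const v y))
    have d2 : HasFDerivAt (fun z => L' (f z) (T v)) _ y :=
      (HasFDerivAt.comp (g := L') y hL'.hasFDerivAt hfd.hasFDerivAt).clm_apply
        (hasFDerivAt_const (T v) y)
    have := DFunLike.congr_fun (d1.unique (d2.congr_of_eventuallyEq (h.mono fun z hz => hz v)))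
      (L y u)
    simp [h.self_of_nhds] at this
    rw [add_comm, this]
  have hs := (hf.isSymmSndFDerivAt (by simp)).eq (L y u) (L y v)
  rw [map_sub, ← key, ← key, hs]
  abel

end Calculus

/-! ### Translations and invariant frames on a Lie group -/

section LieGroup

variable {E : Type*} [NormedAddCommGroup E] [NormedSpace ℝ E]
  {H : Type*} [TopologicalSpace H] {I : ModelWithCorners ℝ E H}
  {G : Type*} [TopologicalSpace G] [ChartedSpace H G] [Group G]

variable (I) in
/-- The differential at `z` of the left translation by `a`. All tangent spaces are identified with
the model space `E`. -/
def dl (a z : G) : E →L[ℝ] E := mfderiv I I (fun y => a * y) z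

variable (I) in
/-- The differential at `z` of the right translation by `a`. -/
def dr (a z : G) : E →L[ℝ] E := mfderiv I I (fun y => y * a) z

variable (I) in
/-- The left invariant frame, `v ↦ (dL_x)_1 v`. -/
def leftFrame (x : G) : E →L[ℝ] TangentSpace I x := dl I x 1

variable (I) in
/-- The adjoint action `Ad(a⁻¹)` on the Lie algebra `E = T_1 G`, the differential at `1` of
`x ↦ a⁻¹ x a`. -/
def adInv (a : G) : E →L[ℝ] E := dl I a⁻¹ a ∘L dr I a 1

@[simp]
theorem dl_one (z : G) (v : E) : dl I 1 z v = v := by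
  have h : (fun y : G => 1 * y) = id := by funext y; simp
  rw [dl, h, mfderiv_id]
  rfl

@[simp]
theorem dr_one (z : G) (v : E) : dr I 1 z v = v := by
  have h : (fun y : G => y * 1) = id := by funext y; simp
  rw [dr, h, mfderiv_id]
  rfl

theorem adInv_one (v : E) : adInv I (1 : G) v = v := by
  simp [adInv]

variable [LieGroup I ∞ G]

theorem mdifferentiableAt_mul_left (a z : G) : MDifferentiableAt I I (fun y => a * y) z :=
  (contMDiff_mul_left (I := I) (n := ∞)).mdifferentiableAt (by simp)

theorem mdifferentiableAt_mul_right (a z : G) : MDifferentiableAt I I (fun y => y * a) z :=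
  (contMDiff_mul_right (I := I) (n := ∞)).mdifferentiableAt (by simp)

theorem dl_dl (a b z : G) (v : E) : dl I a (b * z) (dl I b z v) = dl I (a * b) z v := by
  have h := mfderiv_comp z (mdifferentiableAt_mul_left (I := I) a (b * z))
    (mdifferentiableAt_mul_left (I := I) b z)
  have h2 : (fun y => a * y) ∘ (fun y => b * y) = fun y => a * b * y := by
    funext y; simp [mul_assoc]
  rw [h2] at h
  exact (DFunLike.congr_fun h v).symm

theorem dr_dr (a b z : G) (v : E) : dr I a (z * b) (dr I b z v) = dr I (b * a) z v := by
  have h := mfderiv_comp z (mdifferentiableAt_mul_right (I := I) a (z * b))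
    (mdifferentiableAt_mul_right (I := I) b z)
  have h2 : (fun y => y * a) ∘ (fun y => y * b) = fun y => y * (b * a) := by
    funext y; simp [mul_assoc]
  rw [h2] at h
  exact (DFunLike.congr_fun h v).symm

theorem dl_dr (a b z : G) (v : E) : dl I a (z * b) (dr I b z v) = dr I b (a * z) (dl I a z v) := by
  have h := mfderiv_comp z (mdifferentiableAt_mul_left (I := I) a (z * b))
    (mdifferentiableAt_mul_right (I := I) b z)
  have h' := mfderiv_comp z (mdifferentiableAt_mul_right (I := I) b (a * z))
    (mdifferentiableAt_mul_left (I := I) a z)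
  have h2 : (fun y => a * y) ∘ (fun y => y * b) = (fun y => y * b) ∘ (fun y => a * y) := by
    funext y; simp [mul_assoc]
  rw [h2, h'] at h
  exact (DFunLike.congr_fun h v).symm

theorem dl_leftFrame (a z : G) (v : E) :
    dl I a z (leftFrame I z v) = leftFrame I (a * z) v := by
  have := dl_dl (I := I) a z 1 v
  rwa [mul_one] at this

theorem leftFrame_adInv (a : G) (v : E) : leftFrame I a (adInv I a v) = dr I a 1 v := by
  have := dl_dl (I := I) a a⁻¹ a (dr I a 1 v)
  rw [inv_mul_cancel, mul_inv_cancel, dl_one] at this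
  exact this

/-- Right translations map left invariant fields to left invariant fields. -/
theorem dr_leftFrame (a z : G) (v : E) :
    dr I a z (leftFrame I z v) = leftFrame I (z * a) (adInv I a v) := by
  have := dl_dr (I := I) z a 1 v
  rw [mul_one, one_mul] at this
  rw [← dl_leftFrame, leftFrame_adInv, this]
  rfl

theorem isInvertible_leftFrame (x : G) : (leftFrame I x).IsInvertible := by
  have h1 : ∀ v, dl I x⁻¹ x (dl I x 1 v) = v := fun v => by
    simpa using dl_dl (I := I) x⁻¹ x 1 v
  have h2 : ∀ v, dl I x 1 (dl I x⁻¹ x v) = v := fun v => by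
    simpa using dl_dl (I := I) x x⁻¹ x v
  exact ContinuousLinearMap.IsInvertible.of_inverse (g := (dl I x⁻¹ x : E →L[ℝ] E))
    (ContinuousLinearMap.ext h2) (ContinuousLinearMap.ext h1)

theorem adInv_surjective (a : G) (w : E) : ∃ v, adInv I a v = w := by
  refine ⟨dr I a⁻¹ a (dl I a 1 w), ?_⟩
  have h1 : dr I a 1 (dr I a⁻¹ a (dl I a 1 w)) = dl I a 1 w := by
    simpa using dr_dr (I := I) a a⁻¹ a (dl I a 1 w)
  have h2 : dl I a⁻¹ a (dl I a 1 w) = w := by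
    simpa using dl_dl (I := I) a⁻¹ a 1 w
  change dl I a⁻¹ a (dr I a 1 _) = w
  rw [h1, h2]

end LieGroup

/-! ### Naturality of the bracket of a frame -/

section ManifoldBracket

variable {E : Type*} [NormedAddCommGroup E] [NormedSpace ℝ E]
  {H : Type*} [TopologicalSpace H] {I : ModelWithCorners ℝ E H}
  {M : Type*} [TopologicalSpace M] [ChartedSpace H M]
  {V : Type*} [NormedAddCommGroup V] [NormedSpace ℝ V]
  {X : Type*} [NormedAddCommGroup X] [NormedSpace ℝ X]

/-- The value at `x` of the Lie bracket of the fields `e · u` and `e · v`, in the chart at `x`. -/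
def frameBracket (e : (x : M) → V →L[ℝ] TangentSpace I x) (x : M) (u v : V) : E :=
  fderiv ℝ (frameInChart e x) (extChartAt I x x) (frameInChart e x (extChartAt I x x) u) v -
    fderiv ℝ (frameInChart e x) (extChartAt I x x) (frameInChart e x (extChartAt I x x) v) u

theorem contDiffAt_extChartAt_comp [IsManifold I ∞ M] {f : X → M} {q : X} {z : M}
    (hf : ContMDiffAt 𝓘(ℝ, X) I ∞ f q) (hz : f q ∈ (extChartAt I z).source) :
    ContDiffAt ℝ ∞ (fun q => extChartAt I z (f q)) q := by
  rw [extChartAt_source] at hz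
  exact ((contMDiffAt_extChartAt' hz).comp q hf).contDiffAt

variable [I.Boundaryless]

theorem contMDiffAt_extChartAt_symm_comp [IsManifold I ∞ M] {f : X → E} {q : X} {z : M}
    (hf : ContDiffAt ℝ ∞ f q) (hz : f q ∈ (extChartAt I z).target) :
    ContMDiffAt 𝓘(ℝ, X) I ∞ (fun q => (extChartAt I z).symm (f q)) q :=
  ((contMDiffOn_extChartAt_symm z).contMDiffAt (extChartAt_target_mem_nhds' hz)).comp q
    hf.contMDiffAt

theorem mfderiv_extChartAt_mfderiv [IsManifold I 1 M] {h : M → M} {w z x : M} (hw : h w = z)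
    (hh : MDifferentiableAt I I h w) (hz : z ∈ (extChartAt I x).source) (v : E) :
    (mfderiv I 𝓘(ℝ, E) (extChartAt I x) z : E →L[ℝ] E) ((mfderiv I I h w : E →L[ℝ] E) v) =
      fderiv ℝ (fun t => extChartAt I x (h ((extChartAt I w).symm t))) (extChartAt I w w) v := by
  subst hw
  have h1 : MDifferentiableAt I 𝓘(ℝ, E) (extChartAt I x) (h w) :=
    mdifferentiableAt_extChartAt (by rwa [← extChartAt_source (I := I)])
  have h2 := mfderiv_comp w h1 hh
  have h3 := h1.comp w hh
  rw [h3.mfderiv, I.range_eq_univ, fderivWithin_univ] at h2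
  exact (DFunLike.congr_fun h2 v).symm

/-- A smooth map that intertwines a frame with itself up to a linear map `T` of the model space
intertwines the brackets in the frame. -/
theorem frameBracket_natural [IsManifold I ∞ M] {e : (x : M) → V →L[ℝ] TangentSpace I x}
    (he : ∀ x, ContDiffOn ℝ ∞ (frameInChart e x) (extChartAt I x).target)
    {f : M → M} (hf : ContMDiff I I ∞ f) {T : V →L[ℝ] V}
    (h : ∀ z v, (mfderiv I I f z : E →L[ℝ] E) (e z v) = e (f z) (T v)) {x : M} {u v w : V}
    (hw : frameBracket e x u v = e x w) :
    frameBracket e (f x) (T u) (T v) = e (f x) (T w) := by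
  set y := extChartAt I x x with hy
  set l : E → E := fun z => extChartAt I (f x) (f ((extChartAt I x).symm z)) with hl
  have hly : l y = extChartAt I (f x) (f x) := by simp [hl, hy]
  have hlc : ContDiffAt ℝ ∞ l y := by
    refine contDiffAt_extChartAt_comp ?_ (by simp [hy])
    exact (hf _).comp y (contMDiffAt_extChartAt_symm_comp contDiffAt_id (mem_extChartAt_target x))
  have hL : ∀ x, DifferentiableAt ℝ (frameInChart e x) (extChartAt I x x) := fun x =>
    ((he x).contDiffAt (extChartAt_target_mem_nhds x)).differentiableAt (by simp)
  have hcont : ContinuousAt (fun z => f ((extChartAt I x).symm z)) y :=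
    ContinuousAt.comp (hf.continuous.continuousAt) (continuousAt_extChartAt_symm x)
  have hev : ∀ᶠ z in nhds y, ∀ v,
      fderiv ℝ l z (frameInChart e x z v) = frameInChart e (f x) (l z) (T v) := by
    have h1 : (extChartAt I (f x)).source ∈ nhds (f ((extChartAt I x).symm y)) := by
      rw [hy, extChartAt_to_inv]; exact extChartAt_source_mem_nhds _
    filter_upwards [extChartAt_target_mem_nhds (I := I) x, hcont.eventually h1] with z hz hz' v
    have a1 : MDifferentiableAt 𝓘(ℝ, E) I (extChartAt I x).symm z :=
      (contMDiffAt_extChartAt_symm_comp (I := I) (f := id) contDiffAt_id hz).mdifferentiableAt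
        (by simp)
    have a2 : MDifferentiableAt I I f ((extChartAt I x).symm z) :=
      hf.mdifferentiableAt (by simp)
    have a3 : MDifferentiableAt I 𝓘(ℝ, E) (extChartAt I (f x)) (f ((extChartAt I x).symm z)) :=
      mdifferentiableAt_extChartAt (by rwa [← extChartAt_source (I := I)])
    have b1 : fderiv ℝ l z = (mfderiv I 𝓘(ℝ, E) (extChartAt I (f x)) (f ((extChartAt I x).symm z)) :
        E →L[ℝ] E) ∘L ((mfderiv I I f ((extChartAt I x).symm z) : E →L[ℝ] E) ∘L
          (mfderiv 𝓘(ℝ, E) I (extChartAt I x).symm z : E →L[ℝ] E)) := by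
      rw [← mfderiv_eq_fderiv]
      have := mfderiv_comp z a3 (a2.comp z a1)
      rw [mfderiv_comp z a2 a1] at this
      exact this
    rw [b1]
    have b2 := mfderiv_extChartAt_symm_comp x hz (e _ v)
    have b3 := h ((extChartAt I x).symm z) v
    have b4 : (extChartAt I (f x)).symm (l z) = f ((extChartAt I x).symm z) :=
      (extChartAt I (f x)).left_inv hz'
    have b5 : ∀ c d, c = d → (mfderiv I 𝓘(ℝ, E) (extChartAt I (f x)) c (e c (T v)) : E) =
        mfderiv I 𝓘(ℝ, E) (extChartAt I (f x)) d (e d (T v)) := by rintro _ _ rfl; rfl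
    refine Eq.trans ?_ (b5 _ _ b4).symm
    refine congrArg (mfderiv I 𝓘(ℝ, E) (extChartAt I (f x)) (f ((extChartAt I x).symm z)) :
        E →L[ℝ] E) ?_
    exact (congrArg (mfderiv I I f ((extChartAt I x).symm z) : E →L[ℝ] E) b2).trans b3
  have key := bracket_natural (hlc.of_le ENat.LEInfty.out) (hL x)
    (by rw [hly]; exact hL _) hev u v
  have hw' : fderiv ℝ l y (frameBracket e x u v) = frameBracket e (f x) (T u) (T v) := by
    rw [hly] at key
    exact key
  have := hev.self_of_nhds w
  rw [hly, frameInChart_self, frameInChart_self] at this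
  rw [← hw', hw]
  exact this

end ManifoldBracket

/-! ### The Lie algebra and the adjoint action -/

section GroupFrame

variable {E : Type*} [NormedAddCommGroup E] [NormedSpace ℝ E]
  {H : Type*} [TopologicalSpace H] {I : ModelWithCorners ℝ E H}
  {G : Type*} [TopologicalSpace G] [ChartedSpace H G] [Group G]

variable (I G) in
/-- The Lie bracket on `E = T_1 G`: the bracket of left invariant vector fields, at `1`. -/
def groupBracket : E →L[ℝ] E →L[ℝ] E :=
  fderiv ℝ (frameInChart (leftFrame I) (1 : G)) (extChartAt I (1 : G) 1) -
    (fderiv ℝ (frameInChart (leftFrame I) (1 : G)) (extChartAt I (1 : G) 1)).flip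

theorem leftFrame_one (v : E) : (leftFrame I (1 : G) v : E) = v := dl_one 1 v

variable (I) in
/-- The right invariant frame, `v ↦ (dR_x)_1 v`. -/
def rightFrame (x : G) : E →L[ℝ] TangentSpace I x := dr I x 1

variable [LieGroup I ∞ G]

theorem frameBracket_one (u v : E) :
    frameBracket (leftFrame I) (1 : G) u v = leftFrame I (1 : G) (groupBracket I G u v) := by
  refine Eq.trans ?_ (leftFrame_one _).symm
  have h : ∀ v, frameInChart (leftFrame I) (1 : G) (extChartAt I (1 : G) 1) v = v := fun v => by
    rw [frameInChart_self]
    exact leftFrame_one v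
  rw [frameBracket, h, h]
  rfl

theorem frameInChart_adInv (x : G) (y : E) (v : E) :
    frameInChart (leftFrame I) x y (adInv I ((extChartAt I x).symm y) v) =
      frameInChart (rightFrame I) x y v :=
  congrArg (mfderiv I 𝓘(ℝ, E) (extChartAt I x) ((extChartAt I x).symm y)) (leftFrame_adInv _ v)

variable [I.Boundaryless]

/-- The product of two points that are given in the charts at `a` and `c`, in the chart at `x`. -/
theorem contDiffAt_mul_inChart {X : Type*} [NormedAddCommGroup X] [NormedSpace ℝ X] {k l : X → E}
    {q : X} {a c x : G} (hk : ContDiffAt ℝ ∞ k q) (hl : ContDiffAt ℝ ∞ l q)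
    (hkt : k q ∈ (extChartAt I a).target) (hlt : l q ∈ (extChartAt I c).target)
    (hx : (extChartAt I a).symm (k q) * (extChartAt I c).symm (l q) ∈ (extChartAt I x).source) :
    ContDiffAt ℝ ∞
      (fun q => extChartAt I x ((extChartAt I a).symm (k q) * (extChartAt I c).symm (l q))) q :=
  contDiffAt_extChartAt_comp ((contMDiffAt_extChartAt_symm_comp hk hkt).mul
    (contMDiffAt_extChartAt_symm_comp hl hlt)) hx

theorem frameInChart_leftFrame_eq (x : G) {y : E} (hy : y ∈ (extChartAt I x).target) :
    frameInChart (leftFrame I) x y = fderiv ℝ (fun t => extChartAt I x ((extChartAt I x).symm y *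
      (extChartAt I (1 : G)).symm t)) (extChartAt I (1 : G) 1) := by
  ext v
  exact mfderiv_extChartAt_mfderiv (h := fun z => (extChartAt I x).symm y * z) (mul_one _)
    (mdifferentiableAt_mul_left _ _) ((extChartAt I x).map_target hy) v

theorem frameInChart_rightFrame_eq (x : G) {y : E} (hy : y ∈ (extChartAt I x).target) :
    frameInChart (rightFrame I) x y = fderiv ℝ (fun s => extChartAt I x
      ((extChartAt I (1 : G)).symm s * (extChartAt I x).symm y)) (extChartAt I (1 : G) 1) := by
  ext v
  exact mfderiv_extChartAt_mfderiv (h := fun z => z * (extChartAt I x).symm y) (one_mul _)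
    (mdifferentiableAt_mul_right _ _) ((extChartAt I x).map_target hy) v

theorem contDiffOn_leftFrame (x : G) :
    ContDiffOn ℝ ∞ (frameInChart (leftFrame I) x) (extChartAt I x).target := by
  refine ContDiffOn.congr (fun y hy => ContDiffAt.contDiffWithinAt ?_)
    fun y hy => frameInChart_leftFrame_eq x hy
  refine ContDiffAt.fderiv (n := ∞) ?_ contDiffAt_const (by simp)
  exact contDiffAt_mul_inChart (k := Prod.fst) (l := Prod.snd) contDiffAt_fst contDiffAt_snd hy
    (mem_extChartAt_target _) (by simpa using (extChartAt I x).map_target hy)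

theorem contDiffOn_rightFrame (x : G) :
    ContDiffOn ℝ ∞ (frameInChart (rightFrame I) x) (extChartAt I x).target := by
  refine ContDiffOn.congr (fun y hy => ContDiffAt.contDiffWithinAt ?_)
    fun y hy => frameInChart_rightFrame_eq x hy
  refine ContDiffAt.fderiv (n := ∞) ?_ contDiffAt_const (by simp)
  exact contDiffAt_mul_inChart (k := Prod.snd) (l := Prod.fst) contDiffAt_snd contDiffAt_fst
    (mem_extChartAt_target _) hy (by simpa using (extChartAt I x).map_target hy)

theorem isSmoothFun_adInv [CompleteSpace E] (v : E) :
    IsSmoothFun I (fun a : G => adInv I a v) := by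
  intro x
  have h : ∀ y ∈ (extChartAt I x).target, adInv I ((extChartAt I x).symm y) v =
      (frameInChart (leftFrame I) x y).inverse (frameInChart (rightFrame I) x y v) := by
    intro y hy
    obtain ⟨a, ha⟩ := isInvertible_frameInChart (isInvertible_leftFrame (I := I) (G := G)) x hy
    rw [← frameInChart_adInv, ← ha]
    simp
  refine ContDiffOn.congr ?_ h
  have hinv : ContDiffOn ℝ ∞ (fun y => (frameInChart (leftFrame I) x y).inverse)
      (extChartAt I x).target := by
    intro y hy
    obtain ⟨a, ha⟩ := isInvertible_frameInChart (isInvertible_leftFrame (I := I) (G := G)) x hy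
    have := contDiffAt_map_inverse (𝕜 := ℝ) (n := ∞) a
    rw [ha] at this
    exact this.comp_contDiffWithinAt y (contDiffOn_leftFrame x y hy)
  exact hinv.clm_apply ((contDiffOn_rightFrame x).clm_apply contDiffOn_const)

/-- Brackets of left invariant fields are left invariant. -/
theorem frameBracket_leftFrame (x : G) (u v : E) :
    frameBracket (leftFrame I) x u v = leftFrame I x (groupBracket I G u v) := by
  have := frameBracket_natural (I := I) (e := leftFrame I) contDiffOn_leftFrame
    (contMDiff_mul_left (a := x)) (T := ContinuousLinearMap.id ℝ E) (fun z v => dl_leftFrame x z v)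
    (frameBracket_one (I := I) (G := G) u v)
  rw [mul_one] at this
  exact this

/-- The adjoint action is by automorphisms of the Lie algebra: right translations intertwine left
invariant fields up to the adjoint action. -/
theorem adInv_bracket (a : G) (u v : E) :
    adInv I a (groupBracket I G u v) = groupBracket I G (adInv I a u) (adInv I a v) := by
  have := frameBracket_natural (I := I) (e := leftFrame I) contDiffOn_leftFrame
    (contMDiff_mul_right (a := a)) (T := adInv I a) (fun z v => dr_leftFrame a z v)
    (frameBracket_one (I := I) (G := G) u v)
  rw [one_mul, frameBracket_leftFrame] at this
  obtain ⟨c, hc⟩ := isInvertible_leftFrame (I := I) a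
  rw [← hc] at this
  exact (c.injective this).symm

/-- The derivative of the adjoint action along left invariant fields. The reason is that left and
right invariant vector fields commute. -/
theorem frameDeriv_adInv [CompleteSpace E] (u v : E) (x : G) :
    frameDeriv (leftFrame I) u (fun a : G => adInv I a v) x =
      groupBracket I G (adInv I x v) u := by
  set y₀ := extChartAt I x x with hy₀
  set t₁ := extChartAt I (1 : G) 1 with ht₁
  set L := frameInChart (leftFrame I) x with hL
  set A : E → E := fun y => adInv I ((extChartAt I x).symm y) v with hA
  have ht : (extChartAt I (1 : G)).symm t₁ = 1 := extChartAt_to_inv (1 : G)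
  have hx : (extChartAt I x).symm y₀ = x := extChartAt_to_inv x
  have hLd : DifferentiableAt ℝ L y₀ :=
    ((contDiffOn_leftFrame x).contDiffAt (extChartAt_target_mem_nhds x)).differentiableAt (by simp)
  have hAd : DifferentiableAt ℝ A y₀ :=
    ((isSmoothFun_adInv v x).contDiffAt (extChartAt_target_mem_nhds x)).differentiableAt (by simp)
  have hA0 : A y₀ = adInv I x v := by simp only [hA, hx]
  -- the two partial products in charts
  set τ : E → E := fun t => extChartAt I x (x * (extChartAt I (1 : G)).symm t) with hτ
  set σ : E → E := fun s => extChartAt I x ((extChartAt I (1 : G)).symm s * x) with hσ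
  have hτ0 : τ t₁ = y₀ := by simp only [hτ, ht, mul_one, hy₀]
  have hσ0 : σ t₁ = y₀ := by simp only [hσ, ht, one_mul, hy₀]
  have hxs : x ∈ (extChartAt I x).source := mem_extChartAt_source x
  have h1t : t₁ ∈ (extChartAt I (1 : G)).target := mem_extChartAt_target 1
  have hs1 : ContMDiffAt 𝓘(ℝ, E) I ∞ (extChartAt I (1 : G)).symm t₁ :=
    contMDiffAt_extChartAt_symm_comp (f := id) contDiffAt_id h1t
  have hτc : ContMDiffAt 𝓘(ℝ, E) I ∞ (fun t => x * (extChartAt I (1 : G)).symm t) t₁ :=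
    contMDiffAt_const.mul hs1
  have hσc : ContMDiffAt 𝓘(ℝ, E) I ∞ (fun s => (extChartAt I (1 : G)).symm s * x) t₁ :=
    hs1.mul contMDiffAt_const
  have hτd : DifferentiableAt ℝ τ t₁ :=
    (contDiffAt_extChartAt_comp hτc (by simpa only [ht, mul_one, one_mul] using hxs)).differentiableAt
      (by simp)
  have hσd : DifferentiableAt ℝ σ t₁ :=
    (contDiffAt_extChartAt_comp hσc (by simpa only [ht, mul_one, one_mul] using hxs)).differentiableAt
      (by simp)
  have hτ' : ∀ w, fderiv ℝ τ t₁ w = L y₀ w := fun w => by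
    rw [hL, frameInChart_leftFrame_eq x (mem_extChartAt_target x), hx]
  have hσ' : ∀ w, fderiv ℝ σ t₁ w = L y₀ (adInv I x w) := fun w => by
    have h1 := frameInChart_adInv (I := I) x y₀ w
    have h2 := DFunLike.congr_fun
      (frameInChart_rightFrame_eq (I := I) x (mem_extChartAt_target x)) w
    rw [hx] at h1 h2
    rw [hL, h1]
    exact h2.symm
  -- the double product `(s, t) ↦ s x t` in charts
  set Φ : E × E → E := fun p => extChartAt I x
    ((extChartAt I (1 : G)).symm p.1 * x * (extChartAt I (1 : G)).symm p.2) with hΦ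
  have hΦc : ContDiffAt ℝ 2 Φ (t₁, t₁) := by
    refine (contDiffAt_extChartAt_comp ?_ (by simpa only [ht, mul_one, one_mul] using hxs)).of_le
      ENat.LEInfty.out
    exact ((contMDiffAt_extChartAt_symm_comp (f := Prod.fst) contDiffAt_fst h1t).mul
      contMDiffAt_const).mul (contMDiffAt_extChartAt_symm_comp (f := Prod.snd) contDiffAt_snd h1t)
  -- its partial derivative in `s` is the right invariant field at `x t`, and the one in `t` is the
  -- left invariant field at `s x`; the mixed derivatives agree
  have p1 : (fun t => fderiv ℝ (fun s => Φ (s, t)) t₁ v) =ᶠ[nhds t₁]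
      fun t => L (τ t) (A (τ t)) := by
    have h1 : (extChartAt I x).source ∈ nhds (x * (extChartAt I (1 : G)).symm t₁) := by
      rw [ht, mul_one]; exact extChartAt_source_mem_nhds x
    filter_upwards [hτc.continuousAt.eventually h1] with t hts
    have hts' : x * (extChartAt I (1 : G)).symm t ∈ (extChartAt I x).source := hts
    have e1 : (extChartAt I x).symm (τ t) = x * (extChartAt I (1 : G)).symm t :=
      (extChartAt I x).left_inv hts'
    have h2 := DFunLike.congr_fun (frameInChart_rightFrame_eq (I := I) x
      ((extChartAt I x).map_source hts')) v
    have h3 := frameInChart_adInv (I := I) x (τ t) v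
    refine Eq.trans ?_ (h3.trans h2).symm
    change _ = fderiv ℝ (fun s => extChartAt I x ((extChartAt I (1 : G)).symm s *
      (extChartAt I x).symm (τ t))) t₁ v
    simp only [hΦ, e1, mul_assoc]
  have p2 : (fun s => fderiv ℝ (fun t => Φ (s, t)) t₁ u) =ᶠ[nhds t₁] fun s => L (σ s) u := by
    have h1 : (extChartAt I x).source ∈ nhds ((extChartAt I (1 : G)).symm t₁ * x) := by
      rw [ht, one_mul]; exact extChartAt_source_mem_nhds x
    filter_upwards [hσc.continuousAt.eventually h1] with s hss
    have hss' : (extChartAt I (1 : G)).symm s * x ∈ (extChartAt I x).source := hss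
    have e1 : (extChartAt I x).symm (σ s) = (extChartAt I (1 : G)).symm s * x :=
      (extChartAt I x).left_inv hss'
    rw [hL, frameInChart_leftFrame_eq x ((extChartAt I x).map_source hss')]
    change _ = fderiv ℝ (fun t => extChartAt I x ((extChartAt I x).symm (σ s) *
      (extChartAt I (1 : G)).symm t)) t₁ u
    simp only [hΦ, e1]
  have key := fderiv_partial_comm hΦc u v
  have d1 : HasFDerivAt (fun t => L (τ t) (A (τ t))) _ t₁ :=
    (HasFDerivAt.comp (g := fun y => L y (A y)) t₁ (by
      rw [hτ0]; exact hLd.hasFDerivAt.clm_apply hAd.hasFDerivAt) hτd.hasFDerivAt)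
  have d2 : HasFDerivAt (fun s => L (σ s) u) _ t₁ :=
    (HasFDerivAt.comp (g := fun y => L y u) t₁ (by
      rw [hσ0]; exact hLd.hasFDerivAt.clm_apply (hasFDerivAt_const u y₀)) hσd.hasFDerivAt)
  rw [p1.fderiv_eq, p2.fderiv_eq, d1.fderiv, d2.fderiv] at key
  simp [hτ', hσ', hA0] at key
  have hb := frameBracket_leftFrame (I := I) x (adInv I x v) u
  rw [frameBracket, ← frameInChart_self (leftFrame I) x] at hb
  change fderiv ℝ L y₀ (L y₀ _) u - fderiv ℝ L y₀ (L y₀ u) _ = L y₀ _ at hb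
  change fderiv ℝ A y₀ (L y₀ u) = _
  obtain ⟨c, hc⟩ := isInvertible_frameInChart (isInvertible_leftFrame (I := I) (G := G)) x
    (mem_extChartAt_target x)
  apply c.injective
  change (c : E →L[ℝ] E) _ = (c : E →L[ℝ] E) _
  rw [hc]
  change L y₀ _ = L y₀ _
  rw [← hb, ← key]
  abel

end GroupFrame

/-! ### Orthonormal bases and the Casimir operator -/

section OrthoBasis

variable {V : Type*} [NormedAddCommGroup V] [NormedSpace ℝ V] {B : V →L[ℝ] V →L[ℝ] ℝ}

theorem exists_isOrthoBasis [FiniteDimensional ℝ V] (hs : ∀ v w, B v w = B w v)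
    (hp : ∀ v, v ≠ 0 → 0 < B v v) :
    ∃ b : Module.Basis (Fin (Module.finrank ℝ V)) ℝ V, IsOrthoBasis B 1 b := by
  let B' : LinearMap.BilinForm ℝ V := B.toLinearMap₁₂
  obtain ⟨c, hc⟩ := LinearMap.BilinForm.exists_orthogonal_basis (B := B') ⟨fun v w => hs v w⟩
  have hpos : ∀ i, 0 < B (c i) (c i) := fun i => hp _ (c.ne_zero i)
  have hu : ∀ i, IsUnit ((Real.sqrt (B (c i) (c i)))⁻¹) := fun i =>
    (inv_ne_zero (Real.sqrt_pos.2 (hpos i)).ne').isUnit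
  refine ⟨c.isUnitSMul hu, fun i j => ?_⟩
  rw [Module.Basis.isUnitSMul_apply, Module.Basis.isUnitSMul_apply]
  split_ifs with h
  · subst h
    have h1 := Real.mul_self_sqrt (hpos i).le
    have h2 := (Real.sqrt_pos.2 (hpos i)).ne'
    simp only [map_smul, smul_apply, smul_eq_mul]
    field_simp
    rw [sq, h1]
  · have : B (c i) (c j) = 0 := hc h
    simp [this]

/-- The trace of a bilinear map does not depend on the orthonormal basis. -/
theorem IsOrthoBasis.sum_eq_sum {ι κ X : Type*} [Fintype ι] [DecidableEq ι] [Fintype κ]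
    [DecidableEq κ] [AddCommGroup X] [Module ℝ X] {b : Module.Basis ι ℝ V} {c : Module.Basis κ ℝ V}
    (hb : IsOrthoBasis B 1 b) (hc : IsOrthoBasis B 1 c) (T : V →ₗ[ℝ] V →ₗ[ℝ] X) :
    ∑ i, T (b i) (b i) = ∑ i, T (c i) (c i) := by
  -- `ψ` is the inverse of `B`, and sends the coordinates of any orthonormal basis to its vectors
  let ψ : (V →ₗ[ℝ] ℝ) →ₗ[ℝ] V :=
    { toFun := fun φ => ∑ k, φ (b k) • b k
      map_add' := fun φ φ' => by simp [add_smul, Finset.sum_add_distrib]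
      map_smul' := fun r φ => by simp [smul_smul, Finset.smul_sum] }
  have h1 : ∀ i, ψ (b.coord i) = b i := fun i => by
    change ∑ k, b.coord i (b k) • b k = b i
    simp [Finsupp.single_apply]
  have h2 : ∀ i, ψ (c.coord i) = c i := fun i => by
    change ∑ k, c.coord i (b k) • b k = c i
    conv_rhs => rw [← b.sum_repr (c i)]
    refine Finset.sum_congr rfl fun k _ => ?_
    have e1 := hc.apply_left i (b k)
    have e2 := hb.apply_right k (c i)
    rw [Module.Basis.coord_apply, ← one_mul (c.repr (b k) i), ← e1, e2, one_mul]
  have := sum_basis_dual_eq b c T ψ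
  simpa only [h1, h2] using this

/-- A Lie algebra automorphism that preserves `B` commutes with the Casimir operator. -/
theorem IsOrthoBasis.casimir_comm {ι : Type*} [Fintype ι] [DecidableEq ι] {b : Module.Basis ι ℝ V}
    (hb : IsOrthoBasis B 1 b) {br : V →L[ℝ] V →L[ℝ] V} {α : V →L[ℝ] V}
    (hα : Function.Surjective α) (hB : ∀ v w, B (α v) (α w) = B v w)
    (hbr : ∀ u v, α (br u v) = br (α u) (α v)) (w : V) :
    α (∑ i, br (b i) (br (b i) w)) = ∑ i, br (b i) (br (b i) (α w)) := by
  have hinj : Function.Injective α := by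
    refine (injective_iff_map_eq_zero α).2 fun v hv => ?_
    refine b.ext_elem fun i => ?_
    have := hb.apply_left i v
    rw [← hB, hv, map_zero, one_mul] at this
    simp [← this]
  let c := b.map (LinearEquiv.ofBijective α.toLinearMap ⟨hinj, hα⟩)
  have hck : ∀ i, c i = α (b i) := fun i => rfl
  have hc : IsOrthoBasis B 1 c := fun i j => by rw [hck, hck, hB, hb]
  let T : V →ₗ[ℝ] V →ₗ[ℝ] V := LinearMap.mk₂ ℝ (fun u v => br u (br v (α w)))
    (fun _ _ _ => by simp) (fun _ _ _ => by simp) (fun _ _ _ => by simp) (fun _ _ _ => by simp)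
  have := hb.sum_eq_sum hc T
  rw [map_sum]
  simp only [hbr, ← hck]
  exact this.symm

end OrthoBasis

/-! ### Bi-invariant metrics -/

section GroupMetric

variable {E : Type*} [NormedAddCommGroup E] [NormedSpace ℝ E]
  {H : Type*} [TopologicalSpace H] {I : ModelWithCorners ℝ E H}
  {G : Type*} [TopologicalSpace G] [ChartedSpace H G] [Group G]
  {F : Type*} [NormedAddCommGroup F] [NormedSpace ℝ F] {p : ℕ}

/-- The inner product on the Lie algebra `E = T_1 G`. -/
def lieForm (g : BilinField I G) : E →L[ℝ] E →L[ℝ] ℝ := g 1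

theorem groupBracket_swap (u v : E) : groupBracket I G u v = - groupBracket I G v u := by
  simp [groupBracket]

theorem IsBiInvariant.metric_leftFrame {g : BilinField I G} (hg : IsBiInvariant g) (x : G)
    (v w : E) : g x (leftFrame I x v) (leftFrame I x w) = lieForm g v w := by
  have h := DFunLike.congr_fun (DFunLike.congr_fun (congrFun (hg x).1 1) v) w
  -- identify the tangent spaces at two points that are equal, but not by definition
  have h' : ∀ z, z = x → ∀ a c : E, (g z : E →L[ℝ] E →L[ℝ] ℝ) a c =
      (g x : E →L[ℝ] E →L[ℝ] ℝ) a c := by rintro _ rfl _ _; rfl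
  exact (h' _ (mul_one x) _ _).symm.trans h

theorem IsBiInvariant.metric_dr {g : BilinField I G} (hg : IsBiInvariant g) (x : G) (v w : E) :
    g x (dr I x 1 v) (dr I x 1 w) = lieForm g v w := by
  have h := DFunLike.congr_fun (DFunLike.congr_fun (congrFun (hg x).2 1) v) w
  -- identify the tangent spaces at two points that are equal, but not by definition
  have h' : ∀ z, z = x → ∀ a c : E, (g z : E →L[ℝ] E →L[ℝ] ℝ) a c =
      (g x : E →L[ℝ] E →L[ℝ] ℝ) a c := by rintro _ rfl _ _; rfl
  exact (h' _ (one_mul x) _ _).symm.trans h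

theorem IsLeftInvariant.coeff_leftFrame {θ : DiffForm I G p F} (hθ : IsLeftInvariant θ)
    (v : Fin p → E) (x : G) : coeff (leftFrame I) θ v x = (θ 1 : E [⋀^Fin p]→L[ℝ] F) v := by
  have h := DFunLike.congr_fun (congrFun (hθ x) 1) v
  -- identify the tangent spaces at `x * 1` and `x`
  have h' : ∀ z, z = x → ∀ a : Fin p → E, (θ z : E [⋀^Fin p]→L[ℝ] F) a =
      (θ x : E [⋀^Fin p]→L[ℝ] F) a := by rintro _ rfl _; rfl
  exact (h' _ (mul_one x) _).symm.trans h

variable [LieGroup I ∞ G]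

/-- The adjoint action is isometric. -/
theorem IsBiInvariant.lieForm_adInv {g : BilinField I G} (hg : IsBiInvariant g) (a : G) (v w : E) :
    lieForm g (adInv I a v) (adInv I a w) = lieForm g v w := by
  rw [← hg.metric_leftFrame a, ← hg.metric_dr a, leftFrame_adInv, leftFrame_adInv]

variable [I.Boundaryless]

/-- The inner product on the Lie algebra is invariant: this is the derivative of the invariance
under the adjoint action. -/
theorem IsBiInvariant.lieForm_skew [CompleteSpace E] {g : BilinField I G} (hg : IsBiInvariant g)
    (u v w : E) :
    lieForm g (groupBracket I G u v) w = - lieForm g v (groupBracket I G u w) := by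
  set t₁ := extChartAt I (1 : G) 1
  let A : E → E → E := fun v y => adInv I ((extChartAt I (1 : G)).symm y) v
  have hA1 : ∀ v, A v t₁ = v := fun v => by
    simp only [A, t₁, extChartAt_to_inv, adInv_one]
  have hAd : ∀ v, DifferentiableAt ℝ (A v) t₁ := fun v =>
    ((isSmoothFun_adInv v 1).contDiffAt (extChartAt_target_mem_nhds 1)).differentiableAt (by simp)
  have hA' : ∀ v, fderiv ℝ (A v) t₁ u = groupBracket I G v u := fun v => by
    have h1 := frameDeriv_adInv (I := I) u v (1 : G)
    rw [frameDeriv, frameInChart_self, adInv_one] at h1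
    refine Eq.trans ?_ h1
    exact congrArg (fderiv ℝ (A v) t₁) (leftFrame_one u).symm
  have hc : HasFDerivAt (fun y => lieForm g (A v y) (A w y)) (0 : E →L[ℝ] ℝ) t₁ := by
    have : (fun y => lieForm g (A v y) (A w y)) = fun _ => lieForm g v w := by
      funext y; exact hg.lieForm_adInv _ v w
    rw [this]; exact hasFDerivAt_const _ _
  have hd : HasFDerivAt (fun y => lieForm g (A v y) (A w y)) _ t₁ :=
    HasFDerivAt.clm_apply (((lieForm g).hasFDerivAt).comp t₁ (hAd v).hasFDerivAt)
      (hAd w).hasFDerivAt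
  have h := DFunLike.congr_fun (hd.unique hc) u
  simp [hA1, hA'] at h
  rw [groupBracket_swap u v, groupBracket_swap u w]
  simp
  linarith

/-- The left invariant frame of a Lie group with bi-invariant metric. -/
theorem IsBiInvariant.isLieFrame [CompleteSpace E] {g : BilinField I G} (hg : IsBiInvariant g) :
    IsLieFrame g (leftFrame I) (lieForm g) (groupBracket I G) where
  inv := isInvertible_leftFrame
  smooth := contDiffOn_leftFrame
  metric := hg.metric_leftFrame
  bracket x u v := by
    rw [frameInChart_self]
    have := frameBracket_leftFrame (I := I) x u v
    rw [frameBracket, frameInChart_self] at this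
    exact this
  skew := hg.lieForm_skew

end GroupMetric

/-! ### The pullback under multiplication -/

section MultiplicationPullback

variable {E : Type*} [NormedAddCommGroup E] [NormedSpace ℝ E]
  {H : Type*} [TopologicalSpace H] {I : ModelWithCorners ℝ E H}
  {G : Type*} [TopologicalSpace G] [ChartedSpace H G] [Group G]
  {F : Type*} [NormedAddCommGroup F] [NormedSpace ℝ F]

/-- The value at `1` of a one-form on a Lie group, as a linear form on `E = T_1 G`. -/
def formAtOne (φ : DiffForm I G 1 F) : E →L[ℝ] F :=
  (ContinuousAlternatingMap.ofSubsingleton ℝ E F (0 : Fin 1)).symm (φ 1)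

theorem coeff_leftFrame_eq_formAtOne {φ : DiffForm I G 1 F} (hL : IsLeftInvariant φ)
    (v : Fin 1 → E) (x : G) : coeff (leftFrame I) φ v x = formAtOne φ (v 0) := by
  rw [hL.coeff_leftFrame]
  change _ = (φ 1 : E [⋀^Fin 1]→L[ℝ] F) (fun _ => v 0)
  congr 1
  funext i
  fin_cases i
  rfl

/-- The coefficients of the pullback of a left invariant form under the second projection. -/
theorem coeff_pullback_snd {φ : DiffForm I G 1 F} (hL : IsLeftInvariant φ) (v : Fin 1 → E × E)
    (x : G × G) : coeff (prodFrame (leftFrame I)) (pullback (I.prod I) I Prod.snd φ) v x =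
      formAtOne φ (v 0).2 := by
  rw [← coeff_leftFrame_eq_formAtOne hL (fun i => (v i).2) x.2]
  change φ x.2 (fun i => mfderiv (I.prod I) I Prod.snd x _) = _
  rw [mfderiv_snd]
  rfl

variable [LieGroup I ∞ G]

/-- The coefficients of the pullback of a left invariant form under the multiplication. -/
theorem coeff_pullback_mul {φ : DiffForm I G 1 F} (hL : IsLeftInvariant φ) (v : Fin 1 → E × E)
    (x : G × G) :
    coeff (prodFrame (leftFrame I)) (pullback (I.prod I) I (fun z : G × G => z.1 * z.2) φ) v x =
      formAtOne φ (adInv I x.2 (v 0).1) + formAtOne φ (v 0).2 := by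
  rw [← map_add, ← coeff_leftFrame_eq_formAtOne hL
    (fun i => adInv I x.2 (v i).1 + (v i).2) (x.1 * x.2)]
  have hm : MDifferentiableAt (I.prod I) I (fun z : G × G => z.1 * z.2) x :=
    (contMDiff_mul I ∞).mdifferentiableAt (by simp)
  change φ (x.1 * x.2) (fun i => mfderiv (I.prod I) I (fun z : G × G => z.1 * z.2) x _) = φ _ _
  congr 1
  funext i
  rw [mfderiv_prod_eq_add_apply hm]
  have h1 := dr_leftFrame (I := I) x.2 x.1 (v i).1
  have h2 := dl_leftFrame (I := I) x.1 x.2 (v i).2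
  refine Eq.trans (congrArg₂ (fun a c : E => a + c) h1 h2) ?_
  exact (map_add (leftFrame I (x.1 * x.2)) _ _).symm

variable [I.Boundaryless] [CompleteSpace E]

theorem isSmoothFun_clm_adInv (γ : E →L[ℝ] F) (w : E) :
    IsSmoothFun I (fun a : G => γ (adInv I a w)) := fun x =>
  γ.contDiff.comp_contDiffOn (isSmoothFun_adInv w x)

theorem frameDeriv_clm_adInv (γ : E →L[ℝ] F) (u w : E) (x : G) :
    frameDeriv (leftFrame I) u (fun a : G => γ (adInv I a w)) x =
      γ (groupBracket I G (adInv I x w) u) := by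
  rw [← frameDeriv_adInv, frameDeriv, frameDeriv]
  have hd : DifferentiableAt ℝ ((fun a : G => adInv I a w) ∘ (extChartAt I x).symm)
      (extChartAt I x x) :=
    ((isSmoothFun_adInv w x).contDiffAt (extChartAt_target_mem_nhds x)).differentiableAt (by simp)
  have : HasFDerivAt ((fun a : G => γ (adInv I a w)) ∘ (extChartAt I x).symm) _
      (extChartAt I x x) := γ.hasFDerivAt.comp (extChartAt I x x) hd.hasFDerivAt
  rw [this.fderiv]
  rfl

end MultiplicationPullback

/-! ### The two eigenforms -/

section Eigenforms

variable {E : Type*} [NormedAddCommGroup E] [NormedSpace ℝ E] [FiniteDimensional ℝ E]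
  {H : Type*} [TopologicalSpace H] {I : ModelWithCorners ℝ E H} [I.Boundaryless]
  {G : Type*} [TopologicalSpace G] [ChartedSpace H G] [Group G] [LieGroup I ∞ G]
  {F : Type*} [NormedAddCommGroup F] [NormedSpace ℝ F] [FiniteDimensional ℝ F]
  {g : BilinField I G} {ι : Type*} [Fintype ι] [DecidableEq ι] {b : Module.Basis ι ℝ E}

/-- The Casimir operator `∑ᵢ ad(bᵢ)²` of the Lie algebra `E = T_1 G`, for the basis `b`. -/
def casimir (I : ModelWithCorners ℝ E H) (G : Type*) [TopologicalSpace G] [ChartedSpace H G]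
    [Group G] (b : Module.Basis ι ℝ E) (w : E) : E :=
  ∑ i, groupBracket I G (b i) (groupBracket I G (b i) w)

/-- For a left invariant eigenform, `φ ∘ Cas = -2μ φ` on the Lie algebra. -/
theorem formAtOne_casimir (hg : IsBiInvariant g) (hb : IsOrthoBasis (lieForm g) 1 b)
    {φ : DiffForm I G 1 F} (hL : IsLeftInvariant φ) {μ : ℝ} (hφ : laplacian g 1 φ = μ • φ) (w : E) :
    formAtOne φ (casimir I G b w) = -(2 * μ) • formAtOne φ w := by
  have : CompleteSpace E := FiniteDimensional.complete ℝ E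
  have h := hg.isLieFrame.coeff_laplacian_of_const one_ne_zero hb (formAtOne φ)
    (fun v => funext fun x => coeff_leftFrame_eq_formAtOne hL v x) (fun _ => w) 1
  rw [hφ] at h
  have h2 : coeff (leftFrame I) (μ • φ) (fun _ => w) 1 = μ • formAtOne φ w :=
    congrArg (μ • ·) (coeff_leftFrame_eq_formAtOne hL (fun _ => w) 1)
  rw [h2, ← map_sum] at h
  change _ = _ • formAtOne φ (casimir I G b w) at h
  rw [neg_smul, mul_smul, h, smul_smul]
  norm_num

/-- The pullback of a left invariant eigenform under the second projection has constant coefficients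
in the product frame; doubling the metric halves the eigenvalue. -/
theorem pullback_snd_mem_eigenspace (hg : IsBiInvariant g) (hb : IsOrthoBasis (lieForm g) 1 b)
    {φ : DiffForm I G 1 F} (hL : IsLeftInvariant φ) {μ : ℝ} (hφ : laplacian g 1 φ = μ • φ) :
    pullback (I.prod I) I Prod.snd φ ∈ eigenspace (doubleMetric g) 1 F (1 / 2 * μ) := by
  have : CompleteSpace E := FiniteDimensional.complete ℝ E
  have h' := hg.isLieFrame.prod
  have hc : ∀ v, coeff (prodFrame (leftFrame I)) (pullback (I.prod I) I Prod.snd φ) v =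
      fun _ => formAtOne φ (v 0).2 := fun v => funext fun x => coeff_pullback_snd hL v x
  refine ⟨h'.isSmooth_of_coeff fun v => by rw [hc]; exact isSmoothFun_const _,
    ext_of_coeff h'.inv fun v x => ?_⟩
  rw [h'.coeff_laplacian_of_const two_ne_zero (isOrthoBasis_doubleForm hb)
    (fun w => formAtOne φ w.2) hc]
  have h2 : coeff (prodFrame (leftFrame I))
      ((1 / 2 * μ) • pullback (I.prod I) I Prod.snd φ) v x = (1 / 2 * μ) • formAtOne φ (v 0).2 :=
    congrArg ((1 / 2 * μ) • ·) (coeff_pullback_snd hL v x)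
  have h3 := formAtOne_casimir hg hb hL hφ (v 0).2
  rw [casimir, map_sum] at h3
  rw [h2]
  simp [h3, smul_smul]
  congr 1
  ring

/-- One-forms on `G × G` whose coefficients are matrix coefficients `β(Ad(y⁻¹) u)` of the adjoint
representation in the second variable, where `β` is an eigenvector of the Casimir operator. -/
theorem mem_eigenspace_of_coeff_adInv (hg : IsBiInvariant g) (hb : IsOrthoBasis (lieForm g) 1 b)
    {β : E →L[ℝ] F} {μ : ℝ} (hβ : ∀ w, β (casimir I G b w) = -(2 * μ) • β w)
    {Φ : DiffForm (I.prod I) (G × G) 1 F}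
    (hΦ : ∀ v x, coeff (prodFrame (leftFrame I)) Φ v x = β (adInv I x.2 (v 0).1)) :
    Φ ∈ eigenspace (doubleMetric g) 1 F (3 / 2 * μ) := by
  have : CompleteSpace E := FiniteDimensional.complete ℝ E
  have h' := hg.isLieFrame.prod
  have hb' := isOrthoBasis_doubleForm hb
  have hc : ∀ v, coeff (prodFrame (leftFrame I)) Φ v =
      fun x => β (adInv I x.2 (v 0).1) := fun v => funext fun x => hΦ v x
  have hs : ∀ v, IsSmoothFun (I.prod I) (coeff (prodFrame (leftFrame I)) Φ v) := fun v => by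
    rw [hc]; exact isSmoothFun_comp_snd (isSmoothFun_clm_adInv β _)
  have hD : ∀ (γ : E →L[ℝ] F) (u : E × E) (w : E) (x : G × G),
      frameDeriv (prodFrame (leftFrame I)) u (fun x => γ (adInv I x.2 w)) x =
        γ (groupBracket I G (adInv I x.2 w) u.2) := fun γ u w x => by
    rw [frameDeriv_prodFrame_snd (isSmoothFun_clm_adInv γ w), frameDeriv_clm_adInv]
  have hδ : codiff (doubleMetric g) Φ = 0 := by
    refine ext_of_coeff h'.inv fun v x => ?_
    rw [h'.coeff_codiff_one two_ne_zero hb' hs]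
    simp [hc, hD]
    rfl
  -- the coefficients of `dΦ`
  let K : (Fin 2 → E × E) → G → F := fun v a =>
    β (groupBracket I G (adInv I a (v 1).1) (v 0).2) -
      β (groupBracket I G (adInv I a (v 0).1) (v 1).2) -
      β (adInv I a (groupBracket I G (v 0).1 (v 1).1))
  have hKs : ∀ v, IsSmoothFun I (K v) := fun v x =>
    ((isSmoothFun_clm_adInv (β ∘L (groupBracket I G).flip (v 0).2) _ x).sub
      (isSmoothFun_clm_adInv (β ∘L (groupBracket I G).flip (v 1).2) _ x)).sub
      (isSmoothFun_clm_adInv β _ x)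
  have hK : ∀ v, coeff (prodFrame (leftFrame I)) (extD Φ) v = fun x => K v x.2 := fun v => by
    funext x
    rw [h'.coeff_extD_one hs]
    simp [hc, hD, K]
  refine ⟨h'.isSmooth_of_coeff hs, ext_of_coeff h'.inv fun v x => ?_⟩
  rw [h'.coeff_laplacian_one two_ne_zero hb' hδ fun v => by
    rw [hK]; exact isSmoothFun_comp_snd (hKs v)]
  have h2 : coeff (prodFrame (leftFrame I)) ((3 / 2 * μ) • Φ) v x =
      (3 / 2 * μ) • β (adInv I x.2 (v 0).1) := congrArg ((3 / 2 * μ) • ·) (hΦ v x)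
  rw [h2, Fintype.sum_sum_type]
  set α := adInv I x.2
  set w := (v 0).1
  have hcomm : α (casimir I G b w) = casimir I G b (α w) :=
    hb.casimir_comm (adInv_surjective x.2) (hg.lieForm_adInv x.2) (adInv_bracket x.2) w
  -- first factor: no derivatives, and half of the Casimir operator
  have hl : ∀ i, frameDeriv (prodFrame (leftFrame I)) (b.prod b (Sum.inl i))
      (coeff (prodFrame (leftFrame I)) (extD Φ) ![b.prod b (Sum.inl i), v 0]) x -
      (1 / 2 : ℝ) • coeff (prodFrame (leftFrame I)) (extD Φ) ![b.prod b (Sum.inl i),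
        prodBracket (groupBracket I G) (b.prod b (Sum.inl i)) (v 0)] x =
      (1 / 2 : ℝ) • β (α (groupBracket I G (b i) (groupBracket I G (b i) w))) := fun i => by
    have e0 : frameDeriv (prodFrame (leftFrame I)) (b.prod b (Sum.inl i))
        (coeff (prodFrame (leftFrame I)) (extD Φ) ![b.prod b (Sum.inl i), v 0]) x = 0 := by
      rw [hK, frameDeriv_prodFrame_snd (hKs _)]
      simp [frameDeriv]
    rw [e0, hK]
    simp [K, α, w]
  -- second factor: the second derivatives give the Casimir operator
  have hr : ∀ i, frameDeriv (prodFrame (leftFrame I)) (b.prod b (Sum.inr i))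
      (coeff (prodFrame (leftFrame I)) (extD Φ) ![b.prod b (Sum.inr i), v 0]) x -
      (1 / 2 : ℝ) • coeff (prodFrame (leftFrame I)) (extD Φ) ![b.prod b (Sum.inr i),
        prodBracket (groupBracket I G) (b.prod b (Sum.inr i)) (v 0)] x =
      β (groupBracket I G (b i) (groupBracket I G (b i) (α w))) := fun i => by
    have e0 : coeff (prodFrame (leftFrame I)) (extD Φ) ![b.prod b (Sum.inr i), v 0] =
        fun x => (β ∘L (groupBracket I G).flip (b i)) (adInv I x.2 w) := by
      rw [hK]
      funext x
      simp [K, w]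
    rw [e0, hD, hK]
    simp [K]
    rw [groupBracket_swap (groupBracket I G (adInv I x.2 w) (b i)) (b i),
      groupBracket_swap (adInv I x.2 w) (b i)]
    simp [α]
  rw [Finset.sum_congr rfl fun i _ => hl i, Finset.sum_congr rfl fun i _ => hr i,
    ← Finset.smul_sum, ← map_sum, ← map_sum, ← map_sum]
  change -(2 : ℝ)⁻¹ • ((1 / 2 : ℝ) • β (α (casimir I G b w)) + β (casimir I G b (α w))) = _
  rw [hcomm, hβ]
  module

end Eigenforms

end LieForms

end

open LieForms in
theorem theorem1p3
    {E : Type*} [NormedAddCommGroup E] [NormedSpace ℝ E] [FiniteDimensional ℝ E]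
    {H : Type*} [TopologicalSpace H] {I : ModelWithCorners ℝ E H} [I.Boundaryless]
    {G : Type*} [TopologicalSpace G] [ChartedSpace H G] [Group G] [LieGroup I ∞ G]
    [CompactSpace G] [T2Space G]
    (g : Bundle.ContMDiffRiemannianMetric I ∞ E (fun x : G => TangentSpace I x))
    (hg : IsBiInvariant (I := I) g.inner)
    {𝕜 : Type*} [RCLike 𝕜]
    (μ : ℝ) (φ : DiffForm I G 1 𝕜)
    (hφ : φ ∈ eigenspace g.inner 1 𝕜 μ) (hφ0 : φ ≠ 0) (hL : IsLeftInvariant φ) :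
    ∃ Φ₁ Φ₂ : DiffForm (I.prod I) (G × G) 1 𝕜,
      pullback (I.prod I) I (fun x : G × G => x.1 * x.2) φ = Φ₁ + Φ₂ ∧
      Φ₁ ≠ 0 ∧ Φ₁ ∈ eigenspace (doubleMetric g.inner) 1 𝕜 (3 / 2 * μ) ∧
      Φ₂ ≠ 0 ∧ Φ₂ ∈ eigenspace (doubleMetric g.inner) 1 𝕜 (1 / 2 * μ) := by
  obtain ⟨b, hb⟩ := exists_isOrthoBasis (B := lieForm g.inner)
    (fun v w => g.symm 1 v w) (fun v hv => g.pos 1 v hv)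
  have hβ0 : ∃ w, formAtOne φ w ≠ 0 := by
    by_contra! h
    refine hφ0 (ext_of_coeff (isInvertible_leftFrame (I := I)) fun v x => ?_)
    rw [coeff_leftFrame_eq_formAtOne hL, h]
    rfl
  obtain ⟨w, hw⟩ := hβ0
  set Φ₂ : DiffForm (I.prod I) (G × G) 1 𝕜 := pullback (I.prod I) I Prod.snd φ with hΦ₂
  set Φ₁ := pullback (I.prod I) I (fun x : G × G => x.1 * x.2) φ - Φ₂ with hΦ₁
  have hc : ∀ v x, coeff (prodFrame (leftFrame I)) Φ₁ v x =
      formAtOne φ (adInv I x.2 (v 0).1) := fun v x => by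
    rw [hΦ₁, coeff_sub_apply, coeff_pullback_mul hL, hΦ₂, coeff_pullback_snd hL,
      add_sub_cancel_right]
  refine ⟨Φ₁, Φ₂, (sub_add_cancel _ _).symm, fun h => hw ?_,
    mem_eigenspace_of_coeff_adInv hg hb (formAtOne_casimir hg hb hL hφ.2) hc,
    fun h => hw ?_, pullback_snd_mem_eigenspace hg hb hL hφ.2⟩
  · have := hc (fun _ => (w, 0)) 1
    rw [h] at this
    simp only [Prod.snd_one, adInv_one] at this
    exact this.symm
  · have := coeff_pullback_snd hL (fun _ => (0, w)) (1 : G × G)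
    rw [← hΦ₂, h] at this
    exact this.symm
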